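/- **Lemma 3.2.** Let $S$ be a locally Noetherian scheme (for example a smooth projective variety over $\mathbb{C}$), let $E$ be a vector bundle of rank $2$ on $S$, and let $s\in H^0(S,E)$ be a regular section, i.e. at every point $x$ of the zero locus of $s$ the two components of $s$ with respect to a local frame of $E$ near $x$ form a regular sequence in $\mathcal{O}_{S,x}$. Let $Y=s^{-1}(0)\subset S$ be the zero locus of $s$, i.e. the closed subscheme whose ideal sheaf $I_Y$ is the image of $s^\vee:E^\vee\to\mathcal{O}_S$. Let $q:\mathbb{P}E^\vee=\mathrm{Proj}_S(\mathrm{Sym}\,E)\to S$ be the projective bundle of lines in the fibres of $E^\vee$, let $w\in H^0(\mathbb{P}E^\vee,\mathcal{O}_{\mathbb{P}E^\vee}(1))$ be the section corresponding to $s$, i.e. the composition $\mathcal{O}\xrightarrow{q^*s}q^*E\to\mathcal{O}_{\mathbb{P}E^\vee}(1)$ with the tautological surjection, and let $X=w^{-1}(0)\subset\mathbb{P}E^\vee$ be the zero locus of $w$, i.e. the closed subscheme whose ideal sheaf is the image of $w^\vee:\mathcal{O}(1)^\vee\to\mathcal{O}$. Then the composition $X\hookrightarrow\mathbb{P}E^\vee\xrightarrow{q}S$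 identifies $X$ with the blowup of $S$ along $Y$: there is an isomorphism over $S$ between $X$ and $\mathrm{Bl}_Y S=\mathrm{Proj}_S\bigl(\bigoplus_{n\ge 0}I_Y^n\bigr)$. -/

import Mathlib

open CategoryTheory AlgebraicGeometry

universe u

noncomputable section

namespace SectionBlowup

open Limits HomogeneousLocalization

section GradedLocalization

variable {R R' A B : Type u} [CommRing R] [CommRing R'] [CommRing A] [CommRing B]
  [Algebra R A] [Algebra R' B] {𝒜 : ℕ → Submodule R A} {ℬ : ℕ → Submodule R' B}
  [GradedAlgebra 𝒜] [GradedAlgebra ℬ]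

/-- The structure morphism `Proj 𝒜 ⟶ Spec R` of an `ℕ`-graded `R`-algebra. -/
def projToSpec (𝒜 : ℕ → Submodule R A) [GradedAlgebra 𝒜] :
    Proj 𝒜 ⟶ Spec (.of R) :=
  Proj.toSpecZero 𝒜 ≫ Spec.map (CommRingCat.ofHom (algebraMap R (𝒜 0)))

/-- A graded ring homomorphism which exhibits `B` as the localization of `A` at (the image of)
`f ∈ R`. -/
structure IsGradedLocalizationAway (φ : 𝒜 →+*ᵍ ℬ) (f : R) : Prop where
  isUnit : IsUnit (φ (algebraMap R A f))
  surj : ∀ b : B, ∃ (n : ℕ) (a : A), φ (algebraMap R A f) ^ n * b = φ a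
  eq_zero : ∀ a : A, φ a = 0 → ∃ n : ℕ, algebraMap R A f ^ n * a = 0

namespace IsGradedLocalizationAway

variable {φ : 𝒜 →+*ᵍ ℬ} {f : R}

lemma mem_zero (𝒜 : ℕ → Submodule R A) [GradedAlgebra 𝒜] (f : R) (n : ℕ) :
    algebraMap R A f ^ n ∈ 𝒜 0 := by
  rw [← map_pow]
  exact SetLike.algebraMap_mem_graded 𝒜 _

/-- Surjectivity in each degree. -/
lemma surj_homogeneous (h : IsGradedLocalizationAway φ f) {i : ℕ} {b : B} (hb : b ∈ ℬ i) :
    ∃ (n : ℕ) (a : A), a ∈ 𝒜 i ∧ φ (algebraMap R A f) ^ n * b = φ a := by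
  obtain ⟨n, a, ha⟩ := h.surj b
  refine ⟨n, DirectSum.decompose 𝒜 a i, SetLike.coe_mem _, ?_⟩
  have h1 : φ (algebraMap R A f) ^ n * b ∈ ℬ i := by
    rw [← map_pow]
    simpa using SetLike.mul_mem_graded (Graded.map_mem φ (mem_zero 𝒜 f n)) hb
  rw [φ.map_directSumDecompose, ← ha, DirectSum.decompose_of_mem_same ℬ h1]

lemma irrelevant_le (h : IsGradedLocalizationAway φ f) :
    HomogeneousIdeal.irrelevant ℬ ≤ (HomogeneousIdeal.irrelevant 𝒜).map φ := by
  classical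
  intro b hb
  change b ∈ (HomogeneousIdeal.irrelevant ℬ).toIdeal at hb
  change b ∈ (HomogeneousIdeal.irrelevant 𝒜).toIdeal.map φ
  rw [← DirectSum.sum_support_decompose ℬ b]
  refine Ideal.sum_mem _ fun i _ ↦ ?_
  rcases Nat.eq_zero_or_pos i with rfl | hi
  · convert! Ideal.zero_mem _
  obtain ⟨n, a, ha, e⟩ := h.surj_homogeneous (SetLike.coe_mem (DirectSum.decompose ℬ b i))
  rw [← Ideal.unit_mul_mem_iff_mem _ (h.isUnit.pow n), e]
  exact Ideal.mem_map_of_mem _ (HomogeneousIdeal.mem_irrelevant_of_mem 𝒜 hi ha)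

/-- The induced map on the coordinate ring of a chart is a localization. -/
lemma away_isLocalization (h : IsGradedLocalizationAway φ f) {d : ℕ} {s : A} (hs : s ∈ 𝒜 d) :
    letI := (Away.map φ s).toAlgebra
    IsLocalization.Away (fromZeroRingHom 𝒜 (.powers s) (algebraMap R (𝒜 0) f)) (Away ℬ (φ s)) := by
  let := (Away.map φ s).toAlgebra
  have hmap : algebraMap (Away 𝒜 s) (Away ℬ (φ s)) = Away.map φ s := rfl
  have hel : ∀ n, fromZeroRingHom 𝒜 (.powers s) (algebraMap R (𝒜 0) f) ^ n =
      Away.mk 𝒜 hs 0 (algebraMap R A f ^ n) (by simpa using mem_zero 𝒜 f n) := by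
    intro n
    rw [← map_pow, ← map_pow]
    ext
    rw [Away.val_mk]
    rw [← map_pow]
    exact congrArg (Localization.mk (algebraMap R A (f ^ n)))
      (Subtype.ext (pow_zero s).symm : (1 : Submonoid.powers s) = _)
  constructor; constructor
  · rintro ⟨_, n, rfl⟩
    simp only [hel, hmap, Away.map_mk, map_pow]
    obtain ⟨c, hc⟩ := (h.isUnit.pow n).exists_right_inv
    have h0 : φ (algebraMap R A f) ^ n ∈ ℬ 0 := by
      rw [← map_pow]; exact Graded.map_mem φ (mem_zero 𝒜 f n)
    have hc0 : φ (algebraMap R A f) ^ n * (DirectSum.decompose ℬ c 0 : B) = 1 := by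
      have := DirectSum.coe_decompose_mul_of_left_mem_zero ℬ (j := 0) h0 (b := c)
      rw [← this, hc, DirectSum.decompose_of_mem_same ℬ SetLike.GradedOne.one_mem]
    refine isUnit_iff_exists_inv.mpr ⟨Away.mk ℬ (Graded.map_mem φ hs) 0
      (DirectSum.decompose ℬ c 0 : B) (by simp), ?_⟩
    ext
    simp only [val_mul, val_one, Away.val_mk, Localization.mk_mul, hc0]
    simp [← Localization.mk_one]
  · intro z
    obtain ⟨n, b, hb, rfl⟩ := Away.mk_surjective ℬ (Graded.map_mem φ hs) z
    obtain ⟨k, a, ha, e⟩ := h.surj_homogeneous hb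
    refine ⟨⟨Away.mk 𝒜 hs n a ha, ⟨_, k, rfl⟩⟩, ?_⟩
    simp only [hel, hmap, Away.map_mk]
    ext
    simp only [val_mul, Away.val_mk, Localization.mk_mul, ← e, map_pow]
    rw [Localization.mk_eq_mk_iff, Localization.r_iff_exists]
    exact ⟨1, by simp; ring⟩
  · intro x y e
    obtain ⟨n, a, ha, rfl⟩ := Away.mk_surjective 𝒜 hs x
    obtain ⟨m, b, hb, rfl⟩ := Away.mk_surjective 𝒜 hs y
    replace e := congr_arg val e
    simp only [hmap, Away.map_mk, Away.val_mk, Localization.mk_eq_mk_iff,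
      Localization.r_iff_exists] at e
    obtain ⟨⟨_, k, rfl⟩, hc⟩ := e
    obtain ⟨l, hl⟩ := h.eq_zero (s ^ k * (s ^ m * a - s ^ n * b)) (by
      simp only [map_mul, map_sub, map_pow, mul_sub]
      exact sub_eq_zero.mpr hc)
    refine ⟨⟨_, l, rfl⟩, ?_⟩
    simp only [hel]
    ext
    simp only [val_mul, Away.val_mk, Localization.mk_mul]
    rw [Localization.mk_eq_mk_iff, Localization.r_iff_exists]
    refine ⟨⟨s ^ k, k, rfl⟩, ?_⟩
    simp
    linear_combination hl

lemma isOpenImmersion_SpecMap_awayMap (h : IsGradedLocalizationAway φ f) {d : ℕ} {s : A}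
    (hs : s ∈ 𝒜 d) :
    IsOpenImmersion (Spec.map (CommRingCat.ofHom (Away.map φ s))) := by
  let := (Away.map φ s).toAlgebra
  have := h.away_isLocalization hs
  exact IsOpenImmersion.of_isLocalization
    (fromZeroRingHom 𝒜 (.powers s) (algebraMap R (𝒜 0) f))

lemma isOpenImmersion_ι_map (h : IsGradedLocalizationAway φ f) {i : ℕ} (hi : 0 < i) {s : A}
    (hs : s ∈ 𝒜 i) :
    IsOpenImmersion ((Proj.basicOpen ℬ (φ s)).ι ≫ Proj.map φ h.irrelevant_le) := by
  have := h.isOpenImmersion_SpecMap_awayMap hs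
  have e := Proj.awayι_comp_map φ h.irrelevant_le hi s hs
  rw [← Proj.basicOpenIsoSpec_inv_ι, Category.assoc, Iso.inv_comp_eq] at e
  rw [e]
  infer_instance

lemma isOpenImmersion_map (h : IsGradedLocalizationAway φ f) :
    IsOpenImmersion (Proj.map φ h.irrelevant_le) := by
  have hU : ⨆ s : (Σ i : ℕ+, 𝒜 i), Proj.basicOpen 𝒜 (s.2 : A) = ⊤ := by
    rw [← Scheme.OpenCover.iSup_opensRange (Proj.affineOpenCover 𝒜).openCover]
    exact iSup_congr fun s ↦ (Proj.opensRange_awayι 𝒜 (s.2 : A) s.2.2 s.1.2).symm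
  rw [IsZariskiLocalAtTarget.iff_of_iSup_eq_top (P := @IsOpenImmersion) _ hU]
  intro s
  have h2 : IsOpenImmersion ((Proj.map φ h.irrelevant_le ∣_ Proj.basicOpen 𝒜 (s.2 : A)) ≫
      (Proj.basicOpen 𝒜 (s.2 : A)).ι) := by
    rw [morphismRestrict_ι]
    exact h.isOpenImmersion_ι_map s.1.pos s.2.2
  exact IsOpenImmersion.of_comp _ (Proj.basicOpen 𝒜 (s.2 : A)).ι

lemma awayι_projToSpec (𝒜 : ℕ → Submodule R A) [GradedAlgebra 𝒜] {i : ℕ} (hi : 0 < i) {s : A}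
    (hs : s ∈ 𝒜 i) :
    Proj.awayι 𝒜 s hs hi ≫ projToSpec 𝒜 = Spec.map (CommRingCat.ofHom
      ((fromZeroRingHom 𝒜 (.powers s)).comp (algebraMap R (𝒜 0)))) := by
  rw [projToSpec, Proj.awayι_toSpecZero_assoc, ← Spec.map_comp]
  rfl

lemma awayι_map_projToSpec {φ : 𝒜 →+*ᵍ ℬ} [Algebra R R']
    (h : HomogeneousIdeal.irrelevant ℬ ≤ (HomogeneousIdeal.irrelevant 𝒜).map φ)
    (hφ : ∀ r : R, φ (algebraMap R A r) = algebraMap R' B (algebraMap R R' r)) {i : ℕ}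
    (hi : 0 < i) {s : A} (hs : s ∈ 𝒜 i) :
    Proj.awayι ℬ (φ s) (Graded.map_mem φ hs) hi ≫ Proj.map φ h ≫ projToSpec 𝒜 =
      Proj.awayι ℬ (φ s) (Graded.map_mem φ hs) hi ≫
        projToSpec ℬ ≫ Spec.map (CommRingCat.ofHom (algebraMap R R')) := by
  rw [Proj.awayι_comp_map_assoc _ _ hi _ hs, awayι_projToSpec, reassoc_of% awayι_projToSpec,
    ← Spec.map_comp, ← Spec.map_comp]
  congr 1
  ext r
  change val (Away.map φ s (fromZeroRingHom 𝒜 (.powers s) (algebraMap R (𝒜 0) r))) =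
    val (fromZeroRingHom ℬ (.powers (φ s)) (algebraMap R' (ℬ 0) (algebraMap R R' r)))
  have h1 : Away.map φ s (fromZeroRingHom 𝒜 (.powers s) (algebraMap R (𝒜 0) r)) =
    HomogeneousLocalization.mk (x := .powers (φ s)) ⟨0, ⟨φ (algebraMap R A r), Graded.map_mem φ
      (SetLike.algebraMap_mem_graded 𝒜 r)⟩, ⟨φ 1, Graded.map_mem φ SetLike.GradedOne.one_mem⟩,
      (0 : ℕ), by simp⟩ := rfl
  rw [h1, HomogeneousLocalization.val_mk]
  change _ = Localization.mk (algebraMap R' B (algebraMap R R' r)) 1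
  exact congrArg₂ Localization.mk (hφ r) (Subtype.ext (map_one φ))

lemma projToSpec_naturality {φ : 𝒜 →+*ᵍ ℬ} [Algebra R R']
    (h : HomogeneousIdeal.irrelevant ℬ ≤ (HomogeneousIdeal.irrelevant 𝒜).map φ)
    (hφ : ∀ r : R, φ (algebraMap R A r) = algebraMap R' B (algebraMap R R' r)) :
    Proj.map φ h ≫ projToSpec 𝒜 =
      projToSpec ℬ ≫ Spec.map (CommRingCat.ofHom (algebraMap R R')) :=
  (Proj.mapAffineOpenCover _ h).openCover.hom_ext _ _ fun (s : Σ i : ℕ+, 𝒜 i) ↦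
    awayι_map_projToSpec h hφ s.1.pos s.2.2

lemma exists_map_eq (h : IsGradedLocalizationAway φ f) {i : ℕ}
    (hi : 0 < i) {s : A} (hs : s ∈ 𝒜 i) (y : Spec (.of (Away 𝒜 s)))
    (hy : projToSpec 𝒜 (Proj.awayι 𝒜 s hs hi y) ∈ PrimeSpectrum.basicOpen f) :
    ∃ x, Proj.map φ h.irrelevant_le x = Proj.awayι 𝒜 s hs hi y := by
  let := (Away.map φ s).toAlgebra
  have := h.away_isLocalization hs
  have e := PrimeSpectrum.localization_away_comap_range (Away ℬ (φ s))
    (fromZeroRingHom 𝒜 (.powers s) (algebraMap R (𝒜 0) f))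
  rw [← Scheme.Hom.comp_apply, awayι_projToSpec] at hy
  obtain ⟨(z : Spec (.of (Away ℬ (φ s)))), hz⟩ := e.ge (show y ∈ _ from hy)
  refine ⟨Proj.awayι ℬ (φ s) (Graded.map_mem φ hs) hi z, ?_⟩
  rw [← Scheme.Hom.comp_apply, Proj.awayι_comp_map _ _ hi s hs, Scheme.Hom.comp_apply]
  exact congrArg _ hz

/-- `Proj` commutes with localization of the base. -/
lemma isPullback_map (h : IsGradedLocalizationAway φ f) [Algebra R R'] [IsLocalization.Away f R']
    (hφ : ∀ r : R, φ (algebraMap R A r) = algebraMap R' B (algebraMap R R' r)) :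
    IsPullback (projToSpec ℬ) (Proj.map φ h.irrelevant_le)
      (Spec.map (CommRingCat.ofHom (algebraMap R R'))) (projToSpec 𝒜) := by
  have := h.isOpenImmersion_map
  have : IsOpenImmersion (Spec.map (CommRingCat.ofHom (algebraMap R R'))) :=
    IsOpenImmersion.of_isLocalization f
  refine IsOpenImmersion.isPullback _ _ _ _ (projToSpec_naturality _ hφ) (le_antisymm ?_ ?_)
  · intro x hx
    obtain ⟨s, y, rfl⟩ := (Proj.affineOpenCover 𝒜).openCover.exists_eq x
    have e := PrimeSpectrum.localization_away_comap_range R' f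
    exact h.exists_map_eq (Sigma.fst (β := fun i : ℕ+ ↦ 𝒜 i) s).pos
      (Sigma.snd (β := fun i : ℕ+ ↦ 𝒜 i) s).2 y (e.le hx)
  · rintro _ ⟨x, rfl⟩
    refine ⟨projToSpec ℬ x, ?_⟩
    rw [← Scheme.Hom.comp_apply, ← Scheme.Hom.comp_apply, projToSpec_naturality _ hφ]

end IsGradedLocalizationAway
end GradedLocalization

open Scheme.AffineZariskiSite

/-- A quasi-coherent `ℕ`-graded `𝒪_S`-algebra, given by its sections over the affine opens
of `S`: a graded `Γ(S, U)`-algebra `A(U)` for every affine open `U`, with restriction maps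
to the basic open subsets of `U`, such that `A(D(f)) = A(U)_f` for all `f ∈ Γ(S, U)`. -/
structure GradedAlgebraData (S : Scheme.{u}) where
  /-- The sections over an affine open. -/
  obj (U : S.AffineZariskiSite) : Type u
  [commRing (U : S.AffineZariskiSite) : CommRing (obj U)]
  [algebra (U : S.AffineZariskiSite) : Algebra Γ(S, U.toOpens) (obj U)]
  /-- The homogeneous parts. -/
  deg (U : S.AffineZariskiSite) : ℕ → Submodule Γ(S, U.toOpens) (obj U)
  [gradedAlgebra (U : S.AffineZariskiSite) : GradedAlgebra (deg U)]
  /-- The restriction maps. -/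
  res {V U : S.AffineZariskiSite} (h : V ≤ U) : deg U →+*ᵍ deg V
  res_algebraMap {V U : S.AffineZariskiSite} (h : V ≤ U) (r : Γ(S, U.toOpens)) :
    res h (algebraMap _ (obj U) r) =
      algebraMap _ (obj V) (S.presheaf.map (homOfLE (toOpens_mono h)).op r)
  res_self (U : S.AffineZariskiSite) (a : obj U) : res le_rfl a = a
  res_res {W V U : S.AffineZariskiSite} (h : W ≤ V) (h' : V ≤ U) (a : obj U) :
    res h (res h' a) = res (h.trans h') a
  isLocalization (U : S.AffineZariskiSite) (f : Γ(S, U.toOpens)) :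
    IsGradedLocalizationAway (res (U.basicOpen_le f)) f

namespace GradedAlgebraData

attribute [instance] commRing algebra gradedAlgebra

variable {S : Scheme.{u}} (𝒜 : GradedAlgebraData S)

lemma isLocalization_of_le {V U : S.AffineZariskiSite} (h : V ≤ U) :
    ∃ f : Γ(S, U.toOpens), U.basicOpen f = V ∧ IsGradedLocalizationAway (𝒜.res h) f := by
  obtain ⟨f, hf⟩ := h
  obtain rfl : U.basicOpen f = V := Subtype.ext hf
  exact ⟨f, rfl, 𝒜.isLocalization U f⟩

lemma irrelevant_le {V U : S.AffineZariskiSite} (h : V ≤ U) :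
    HomogeneousIdeal.irrelevant (𝒜.deg V) ≤
      (HomogeneousIdeal.irrelevant (𝒜.deg U)).map (𝒜.res h) := by
  obtain ⟨f, -, hf⟩ := 𝒜.isLocalization_of_le h
  exact hf.irrelevant_le

/-- The diagram `U ↦ Proj A(U)`. -/
def projFunctor : S.AffineZariskiSite ⥤ Scheme.{u} where
  obj U := Proj (𝒜.deg U)
  map {V U} h := Proj.map (𝒜.res h.le) (𝒜.irrelevant_le h.le)
  map_id U := by
    rw [← Proj.map_id]
    congr 1
    ext a
    exact 𝒜.res_self U a
  map_comp {W V U} h h' := by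
    rw [← Proj.map_comp]
    congr 1
    ext a
    exact (𝒜.res_res h.le h'.le a).symm

/-- The structure morphisms `Proj A(U) ⟶ Spec Γ(S, U)`. -/
def projFunctorToSpec :
    𝒜.projFunctor ⟶ toOpensFunctor S ⋙ S.presheaf.rightOp ⋙ Scheme.Spec where
  app U := projToSpec (𝒜.deg U)
  naturality V U h :=
    letI := (S.presheaf.map (homOfLE (toOpens_mono h.le)).op).hom.toAlgebra
    IsGradedLocalizationAway.projToSpec_naturality (R := Γ(S, U.toOpens)) (R' := Γ(S, V.toOpens))
      (𝒜.irrelevant_le h.le) (𝒜.res_algebraMap h.le)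

lemma equifibered_projFunctorToSpec : 𝒜.projFunctorToSpec.Equifibered := by
  intro V U h
  obtain ⟨f, rfl, hf⟩ := 𝒜.isLocalization_of_le h.le
  let := (S.presheaf.map (homOfLE (toOpens_mono h.le)).op).hom.toAlgebra
  have : IsLocalization.Away f Γ(S, (U.basicOpen f).toOpens) := U.2.isLocalization_basicOpen f
  exact (hf.isPullback_map (R := Γ(S, U.toOpens)) (R' := Γ(S, (U.basicOpen f).toOpens))
    (𝒜.res_algebraMap h.le)).flip

/-- The gluing data for the relative homogeneous spectrum. -/
def relativeGluingData : (directedCover S).RelativeGluingData where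
  functor := 𝒜.projFunctor
  natTrans := 𝒜.projFunctorToSpec ≫ (restrictIsoSpec S).inv
  equifibered := 𝒜.equifibered_projFunctorToSpec.comp
    (@NatTrans.Equifibered.of_isIso _ _ _ _ _ _ _ (Iso.isIso_inv (restrictIsoSpec S)))

/-- The relative homogeneous spectrum `Proj_S A` of a quasi-coherent graded `𝒪_S`-algebra `A`,
obtained by gluing the schemes `Proj A(U)` for `U ⊆ S` affine open. -/
def relProj : Scheme.{u} := 𝒜.relativeGluingData.glued

/-- The structure morphism `Proj_S A ⟶ S`. -/
def relProjToBase : 𝒜.relProj ⟶ S := 𝒜.relativeGluingData.toBase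

/-- The open immersion `Proj A(U) ⟶ Proj_S A` for an affine open `U ⊆ S`. -/
def projι (U : S.AffineZariskiSite) : Proj (𝒜.deg U) ⟶ 𝒜.relProj :=
  𝒜.relativeGluingData.cover.f U

instance (U : S.AffineZariskiSite) : IsOpenImmersion (𝒜.projι U) :=
  𝒜.relativeGluingData.cover.map_prop U

end GradedAlgebraData

section SymmetricAlgebra

section Grading

variable (R M : Type*) [CommRing R] [AddCommGroup M] [Module R M]

/-- The homogeneous parts of the symmetric algebra: `Symⁿ M` is spanned by the products of
`n` elements of `M`. -/
def symDeg (n : ℕ) : Submodule R (SymmetricAlgebra R M) :=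
  LinearMap.range (SymmetricAlgebra.ι R M) ^ n

variable {R M} in
lemma ι_mem_symDeg (m : M) : SymmetricAlgebra.ι R M m ∈ symDeg R M 1 := by
  rw [symDeg, pow_one]
  exact LinearMap.mem_range_self _ m

instance : SetLike.GradedMonoid (symDeg R M) :=
  inferInstanceAs (SetLike.GradedMonoid fun n : ℕ ↦ LinearMap.range (SymmetricAlgebra.ι R M) ^ n)

open scoped DirectSum in
/-- The inclusion of `M` into the graded pieces of `Sym M`. -/
def symGradedι : M →ₗ[R] ⨁ i : ℕ, symDeg R M i :=
  DirectSum.lof R ℕ (fun i ↦ symDeg R M i) 1 ∘ₗ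
    (SymmetricAlgebra.ι R M).codRestrict _ fun m ↦ ι_mem_symDeg m

lemma symGradedι_apply (m : M) : symGradedι R M m =
    DirectSum.of (fun i : ℕ ↦ symDeg R M i) 1 ⟨SymmetricAlgebra.ι R M m, ι_mem_symDeg m⟩ :=
  rfl

instance symGradedAlgebra : GradedAlgebra (symDeg R M) :=
  GradedAlgebra.ofAlgHom _ (SymmetricAlgebra.lift (symGradedι R M))
    (by
      ext m
      change DirectSum.coeAlgHom (symDeg R M) (SymmetricAlgebra.lift (symGradedι R M)
        (SymmetricAlgebra.ι R M m)) = SymmetricAlgebra.ι R M m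
      rw [SymmetricAlgebra.lift_ι_apply, symGradedι_apply, DirectSum.coeAlgHom_of])
    fun i x ↦ by
    obtain ⟨x, hx⟩ := x
    change x ∈ LinearMap.range (SymmetricAlgebra.ι R M) ^ i at hx
    dsimp only [Subtype.coe_mk, DirectSum.lof_eq_of]
    induction hx using Submodule.pow_induction_on_left' with
    | algebraMap r => rw [AlgHom.commutes, DirectSum.algebraMap_apply]; rfl
    | add x y i hx hy ihx ihy =>
      rw [map_add, ihx, ihy, ← map_add]
      rfl
    | mem_mul m hm i x hx ih =>
      obtain ⟨_, rfl⟩ := hm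
      rw [map_mul, ih, SymmetricAlgebra.lift_ι_apply, symGradedι_apply, DirectSum.of_mul_of]
      exact DirectSum.of_eq_of_gradedMonoid_eq (Sigma.subtype_ext (add_comm _ _) rfl)

end Grading

variable {R R' M M' : Type u} [CommRing R] [CommRing R'] [AddCommGroup M] [Module R M]
  [AddCommGroup M'] [Module R' M']

/-- The ring homomorphism `Sym_R M →+* Sym_R' M'` induced by a semilinear map. -/
def symMapRingHom {σ : R →+* R'} (g : M →ₛₗ[σ] M') :
    SymmetricAlgebra R M →+* SymmetricAlgebra R' M' :=
  letI := ((algebraMap R' (SymmetricAlgebra R' M')).comp σ).toAlgebra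
  (SymmetricAlgebra.lift (R := R) (A := SymmetricAlgebra R' M')
    { toFun m := SymmetricAlgebra.ι R' M' (g m)
      map_add' := by simp
      map_smul' r m := by
        rw [map_smulₛₗ, map_smul]
        exact Algebra.smul_def (σ r) _ } : _ →ₐ[R] _).toRingHom

variable {σ : R →+* R'} (g : M →ₛₗ[σ] M')

@[simp]
lemma symMapRingHom_algebraMap (r : R) : symMapRingHom g (algebraMap R _ r) =
    algebraMap R' _ (σ r) :=
  letI := ((algebraMap R' (SymmetricAlgebra R' M')).comp σ).toAlgebra
  AlgHom.commutes (R := R) (B := SymmetricAlgebra R' M') _ _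

@[simp]
lemma symMapRingHom_ι (m : M) : symMapRingHom g (SymmetricAlgebra.ι R M m) =
    SymmetricAlgebra.ι R' M' (g m) :=
  letI := ((algebraMap R' (SymmetricAlgebra R' M')).comp σ).toAlgebra
  SymmetricAlgebra.lift_ι_apply (R := R) (A := SymmetricAlgebra R' M') _ _

lemma sym_ringHom_ext {B : Type*} [Semiring B] {φ ψ : SymmetricAlgebra R M →+* B}
    (h : ∀ r, φ (algebraMap R _ r) = ψ (algebraMap R _ r))
    (h' : ∀ m, φ (SymmetricAlgebra.ι R M m) = ψ (SymmetricAlgebra.ι R M m)) : φ = ψ := by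
  refine RingHom.ext fun (a : SymmetricAlgebra R M) ↦ ?_
  induction a using SymmetricAlgebra.induction with
  | algebraMap r => exact h r
  | ι m => exact h' m
  | mul a b ha hb => rw [map_mul, map_mul, ha, hb]
  | add a b ha hb => rw [map_add, map_add, ha, hb]

/-- The graded ring homomorphism `Sym_R M →+*ᵍ Sym_R' M'` induced by a semilinear map. -/
def symMap : symDeg R M →+*ᵍ symDeg R' M' where
  __ := symMapRingHom g
  map_mem := by
    intro i x hx
    change x ∈ LinearMap.range (SymmetricAlgebra.ι R M) ^ i at hx
    change symMapRingHom g x ∈ _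
    induction hx using Submodule.pow_induction_on_left' with
    | algebraMap r =>
      rw [symMapRingHom_algebraMap]
      exact SetLike.algebraMap_mem_graded (symDeg R' M') _
    | add x y i hx hy ihx ihy =>
      rw [map_add]
      exact add_mem ihx ihy
    | mem_mul m hm i x hx ih =>
      obtain ⟨m, rfl⟩ := hm
      rw [map_mul, symMapRingHom_ι, Nat.succ_eq_add_one, add_comm]
      exact SetLike.mul_mem_graded (ι_mem_symDeg _) ih

@[simp]
lemma symMap_algebraMap (r : R) : symMap g (algebraMap R _ r) = algebraMap R' _ (σ r) :=
  symMapRingHom_algebraMap g r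

@[simp]
lemma symMap_ι (m : M) : symMap g (SymmetricAlgebra.ι R M m) = SymmetricAlgebra.ι R' M' (g m) :=
  symMapRingHom_ι g m

/-- The symmetric algebra commutes with localization. -/
lemma isGradedLocalizationAway_symMap {f : R}
    (hσ : letI := σ.toAlgebra; IsLocalization.Away f R')
    (surj : ∀ y : M', ∃ (n : ℕ) (x : M), σ f ^ n • y = g x)
    (eq_zero : ∀ x : M, g x = 0 → ∃ n : ℕ, f ^ n • x = 0) :
    IsGradedLocalizationAway (symMap g) f := by
  let := σ.toAlgebra
  have : IsLocalization.Away f R' := hσ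
  have hf : IsUnit (σ f) := IsLocalization.Away.algebraMap_isUnit f
  refine ⟨?_, ?_, ?_⟩
  · rw [symMap_algebraMap]
    exact hf.map _
  · intro b
    rw [symMap_algebraMap]
    induction b using SymmetricAlgebra.induction with
    | algebraMap r =>
      obtain ⟨n, x, hx⟩ := IsLocalization.Away.surj f r
      refine ⟨n, algebraMap R _ x, ?_⟩
      rw [symMap_algebraMap, ← map_pow, ← map_mul, mul_comm]
      exact congrArg _ hx
    | ι y =>
      obtain ⟨n, x, hx⟩ := surj y
      refine ⟨n, SymmetricAlgebra.ι R M x, ?_⟩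
      rw [symMap_ι, ← map_pow, ← Algebra.smul_def, ← map_smul, hx]
    | mul a b ha hb =>
      obtain ⟨n, x, hx⟩ := ha
      obtain ⟨m, y, hy⟩ := hb
      exact ⟨n + m, x * y, by rw [map_mul, ← hx, ← hy]; ring⟩
    | add a b ha hb =>
      obtain ⟨n, x, hx⟩ := ha
      obtain ⟨m, y, hy⟩ := hb
      refine ⟨n + m, algebraMap R _ f ^ m * x + algebraMap R _ f ^ n * y, ?_⟩
      rw [map_add, map_mul, map_mul, ← hx, ← hy, map_pow, map_pow, symMap_algebraMap]
      ring
  · intro a ha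
    let L := Localization.Away (algebraMap R (SymmetricAlgebra R M) f)
    let F : SymmetricAlgebra R M →+* L := algebraMap _ _
    let τ : R' →+* L := IsLocalization.Away.lift f (g := F.comp (algebraMap R _))
      (IsLocalization.Away.algebraMap_isUnit (algebraMap R (SymmetricAlgebra R M) f))
    have hτ (r : R) : τ (σ r) = F (algebraMap R _ r) := IsLocalization.Away.lift_eq f _ r
    have hu : IsUnit (τ (σ f)) := hf.map τ
    -- a chosen inverse of `f`
    choose n x hx using surj
    obtain ⟨c, hc⟩ := hu.exists_left_inv
    have hcn (k : ℕ) : c ^ k * τ (σ f) ^ k = 1 := by rw [← mul_pow, hc, one_pow]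
    have key (y : M') (k : ℕ) (z : M) (h : σ f ^ k • y = g z) :
        c ^ n y * F (SymmetricAlgebra.ι R M (x y)) = c ^ k * F (SymmetricAlgebra.ι R M z) := by
      obtain ⟨l, hl⟩ := eq_zero (f ^ k • x y - f ^ n y • z) (by
        rw [map_sub, map_smulₛₗ, map_smulₛₗ, ← h, ← hx, smul_smul, smul_smul, map_pow, map_pow,
          mul_comm, sub_self])
      have h1 := congrArg (fun m ↦ F (SymmetricAlgebra.ι R M m)) hl
      simp only [map_smul, map_sub, Algebra.smul_def, map_mul, map_zero, map_pow, ← hτ] at h1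
      have h2 := ((hu.pow l).mul_right_eq_zero).mp h1
      linear_combination (-c ^ n y * F (SymmetricAlgebra.ι R M (x y))) * hcn k +
        (c ^ k * F (SymmetricAlgebra.ι R M z)) * hcn (n y) + c ^ k * c ^ n y * h2
    let := τ.toAlgebra
    let G : M' →ₗ[R'] L :=
      { toFun y := c ^ n y * F (SymmetricAlgebra.ι R M (x y))
        map_add' y z := by
          rw [key (y + z) (n y + n z) (f ^ n z • x y + f ^ n y • x z) (by
            rw [map_add, map_smulₛₗ, map_smulₛₗ, ← hx, ← hx, smul_smul, smul_smul, map_pow,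
              map_pow, smul_add, ← pow_add, ← pow_add, add_comm (n z)])]
          simp only [map_add, map_smul, Algebra.smul_def, map_mul, map_pow, ← hτ]
          linear_combination (c ^ n y * F (SymmetricAlgebra.ι R M (x y))) * hcn (n z) +
            (c ^ n z * F (SymmetricAlgebra.ι R M (x z))) * hcn (n y)
        map_smul' r y := by
          obtain ⟨m, s, hs⟩ := IsLocalization.Away.surj f r
          replace hs : r * σ f ^ m = σ s := hs
          rw [key (r • y) (m + n y) (s • x y) (by
            rw [map_smulₛₗ, ← hx, ← hs, smul_smul, smul_smul]; congr 1; ring)]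
          have h3 := congrArg τ hs
          rw [map_mul, map_pow] at h3
          simp only [map_smul, Algebra.smul_def, map_mul, ← hτ, ← h3, RingHom.id_apply]
          change _ = τ r * _
          linear_combination (τ r * c ^ n y * F (SymmetricAlgebra.ι R M (x y))) * hcn m }
    have hG : ((SymmetricAlgebra.lift G : SymmetricAlgebra R' M' →ₐ[R'] L) :
        SymmetricAlgebra R' M' →+* L).comp (symMapRingHom g) = F := by
      refine sym_ringHom_ext (fun r ↦ ?_) (fun m ↦ ?_)
      · simp only [RingHom.comp_apply, symMapRingHom_algebraMap, RingHom.coe_coe,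
          AlgHom.commutes]
        exact hτ r
      · simp only [RingHom.comp_apply, symMapRingHom_ι, RingHom.coe_coe,
          SymmetricAlgebra.lift_ι_apply]
        have := key (g m) 0 m (by simp)
        rw [pow_zero, one_mul] at this
        exact this
    have h0 : F a = 0 := by
      rw [← hG, RingHom.comp_apply]
      rw [show symMapRingHom g a = 0 from ha, map_zero]
    obtain ⟨⟨_, k, rfl⟩, hk⟩ := (IsLocalization.map_eq_zero_iff
      (.powers (algebraMap R (SymmetricAlgebra R M) f)) L a).mp h0
    exact ⟨k, hk⟩

end SymmetricAlgebra

section Modules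

variable {S : Scheme.{u}} (E : S.Modules)

/-- The restriction maps of an `𝒪_S`-module as semilinear maps. -/
def moduleRes {U V : S.Opens} (h : V ≤ U) :
    Γ(E, U) →ₛₗ[(S.presheaf.map (homOfLE h).op).hom] Γ(E, V) where
  toFun x := E.presheaf.map (homOfLE h).op x
  map_add' := map_add _
  map_smul' r x := Scheme.Modules.map_smul E (homOfLE h) r x

lemma moduleRes_self {U : S.Opens} (x : Γ(E, U)) : moduleRes E le_rfl x = x :=
  congr($(E.presheaf.map_id (.op U)) x)

lemma moduleRes_res {U V W : S.Opens} (h : W ≤ V) (h' : V ≤ U) (x : Γ(E, U)) :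
    moduleRes E h (moduleRes E h' x) = moduleRes E (h.trans h') x :=
  congr($(E.presheaf.map_comp (homOfLE h').op (homOfLE h).op) x).symm

section Localization

variable {U : S.Opens}

lemma appIso_inv_fromSpec (hU : IsAffineOpen U) (V : (Spec Γ(S, U)).Opens)
    (h : hU.fromSpec ''ᵁ V ≤ U) :
    (Scheme.ΓSpecIso Γ(S, U)).inv ≫ (Spec Γ(S, U)).presheaf.map V.leTop.op ≫
      (hU.fromSpec.appIso V).inv = S.presheaf.map (homOfLE h).op := by
  rw [← Category.assoc, Iso.comp_inv_eq, Scheme.Hom.appIso_hom', Scheme.Hom.map_appLE,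
    Scheme.Hom.appLE, hU.fromSpec_app_self, Category.assoc, ← Functor.map_comp]
  rfl

lemma restrict_smul (hU : IsAffineOpen U) (V : (Spec Γ(S, U)).Opens) (f : Γ(S, U))
    (h : hU.fromSpec ''ᵁ V ≤ U) (x : Γ(E.restrict hU.fromSpec, V)) :
    f • x = (show Γ(E, hU.fromSpec ''ᵁ V) from
      S.presheaf.map (homOfLE h).op f • (show Γ(E, hU.fromSpec ''ᵁ V) from x)) := by
  rw [Scheme.Modules.smul_Spec_def]
  exact congr($(appIso_inv_fromSpec hU V h) f • (show Γ(E, hU.fromSpec ''ᵁ V) from x))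

variable [SheafOfModules.IsQuasicoherent (R := S.ringCatSheaf) E]

lemma isLocalizing_restrict (hU : IsAffineOpen U) :
    IsLocalizing (modulesSpecToSheaf.obj (E.restrict hU.fromSpec)) := by
  rw [← isIso_fromTildeΓ_iff_isLocalizing]
  have := Scheme.Modules.isQuasicoherent_restrictFunctor hU.fromSpec E
  exact Scheme.Modules.isIso_fromTildeΓ_of_isQuasicoherent _

lemma moduleRes_surj (hU : IsAffineOpen U) (f : Γ(S, U)) (y : Γ(E, S.basicOpen f)) :
    ∃ (n : ℕ) (x : Γ(E, U)),
      (S.presheaf.map (homOfLE (S.basicOpen_le f)).op).hom f ^ n • y =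
        moduleRes E (S.basicOpen_le f) x := by
  let D : (Spec Γ(S, U)).Opens := PrimeSpectrum.basicOpen f
  have h1 : hU.fromSpec ''ᵁ D = S.basicOpen f := hU.fromSpec_image_basicOpen f
  have h2 : hU.fromSpec ''ᵁ ⊤ = U := by simp
  have h3 : hU.fromSpec ''ᵁ D ≤ U := h1.trans_le (S.basicOpen_le f)
  have := isLocalizing_restrict E hU f
  obtain ⟨⟨x, ⟨_, n, rfl⟩⟩, hx⟩ := this.surj (moduleRes E h1.le y)
  refine ⟨n, moduleRes E h2.ge x, ?_⟩
  replace hx : f ^ n • (show Γ(E.restrict hU.fromSpec, D) from moduleRes E h1.le y) =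
    moduleRes E (h3.trans h2.ge) x := hx
  rw [restrict_smul E hU _ _ h3] at hx
  replace hx := congrArg (moduleRes E h1.ge) hx
  refine Eq.trans ?_ ((hx.trans (moduleRes_res E _ _ _)).trans (moduleRes_res E _ _ _).symm)
  refine (((moduleRes E h1.ge).map_smulₛₗ _ _).trans ?_).symm
  rw [moduleRes_res, moduleRes_self, map_pow, map_pow]
  exact congr($(S.presheaf.map_comp (homOfLE h3).op (homOfLE h1.ge).op) f ^ n • y).symm

lemma moduleRes_eq_zero (hU : IsAffineOpen U) (f : Γ(S, U)) (x : Γ(E, U))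
    (hx : moduleRes E (S.basicOpen_le f) x = 0) : ∃ n : ℕ, f ^ n • x = 0 := by
  let D : (Spec Γ(S, U)).Opens := PrimeSpectrum.basicOpen f
  have h1 : hU.fromSpec ''ᵁ D = S.basicOpen f := hU.fromSpec_image_basicOpen f
  have h2 : hU.fromSpec ''ᵁ ⊤ = U := by simp
  have h3 : hU.fromSpec ''ᵁ D ≤ hU.fromSpec ''ᵁ ⊤ :=
    (h1.trans_le (S.basicOpen_le f)).trans h2.ge
  have := isLocalizing_restrict E hU f
  obtain ⟨⟨_, n, rfl⟩, hn⟩ := this.exists_of_eq (x₁ := moduleRes E h2.le x) (x₂ := 0) (by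
    rw [map_zero]
    change moduleRes E h3 (moduleRes E h2.le x) = 0
    rw [moduleRes_res, ← moduleRes_res E h1.le (S.basicOpen_le f), hx, map_zero])
  refine ⟨n, ?_⟩
  rw [smul_zero] at hn
  replace hn : f ^ n • (show Γ(E.restrict hU.fromSpec, ⊤) from moduleRes E h2.le x) = 0 := hn
  rw [restrict_smul E hU _ _ h2.le] at hn
  replace hn := congrArg (moduleRes E h2.ge) hn
  have h4 := ((moduleRes E h2.ge).map_smulₛₗ _ _).symm.trans (hn.trans (map_zero _))
  rw [moduleRes_res, moduleRes_self] at h4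
  refine Eq.trans ?_ h4
  exact (congr($(S.presheaf.map_comp (homOfLE h2.le).op (homOfLE h2.ge).op) (f ^ n) • x).symm.trans
    congr($(S.presheaf.map_id (.op U)) (f ^ n) • x)).symm

end Localization

/-- The symmetric algebra of a quasi-coherent `𝒪_S`-module: over an affine open `U` it is the
symmetric algebra of the `Γ(S, U)`-module `Γ(E, U)`. -/
def symAlgebra [SheafOfModules.IsQuasicoherent (R := S.ringCatSheaf) E] :
    GradedAlgebraData S where
  obj U := SymmetricAlgebra Γ(S, U.toOpens) Γ(E, U.toOpens)
  deg U := symDeg Γ(S, U.toOpens) Γ(E, U.toOpens)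
  res h := symMap (moduleRes E (toOpens_mono h))
  res_algebraMap h r := symMap_algebraMap _ r
  res_self U a := by
    refine RingHom.congr_fun (f := symMapRingHom (moduleRes E le_rfl)) (g := .id _)
      (sym_ringHom_ext (fun r ↦ ?_) fun m ↦ ?_) a
    · rw [symMapRingHom_algebraMap]
      exact congrArg _ congr($(S.presheaf.map_id (.op U.toOpens)) r)
    · rw [symMapRingHom_ι, moduleRes_self]
      rfl
  res_res h h' a := by
    refine RingHom.congr_fun (f := (symMapRingHom (moduleRes E (toOpens_mono h))).comp
      (symMapRingHom (moduleRes E (toOpens_mono h'))))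
      (g := symMapRingHom (moduleRes E (toOpens_mono (h.trans h'))))
      (sym_ringHom_ext (fun r ↦ ?_) fun m ↦ ?_) a
    · rw [RingHom.comp_apply, symMapRingHom_algebraMap, symMapRingHom_algebraMap,
        symMapRingHom_algebraMap]
      exact congrArg _ congr($(S.presheaf.map_comp (homOfLE (toOpens_mono h')).op
        (homOfLE (toOpens_mono h)).op) r).symm
    · rw [RingHom.comp_apply, symMapRingHom_ι, symMapRingHom_ι, symMapRingHom_ι, moduleRes_res]
  isLocalization U f := isGradedLocalizationAway_symMap _ (U.2.isLocalization_basicOpen f)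
    (moduleRes_surj E U.2 f) (moduleRes_eq_zero E U.2 f)

end Modules

section Rees

open Polynomial

section Grading

variable {R : Type u} [CommRing R] (I : Ideal R)

/-- The homogeneous part `Iⁿ tⁿ` of degree `n` of the Rees algebra `⨁ₙ Iⁿ tⁿ`. -/
def reesDeg (n : ℕ) : Submodule R (reesAlgebra I) :=
  (LinearMap.range (monomial n : R →ₗ[R] R[X])).comap (reesAlgebra I).val.toLinearMap

variable {I}

lemma mem_reesDeg {n : ℕ} {x : reesAlgebra I} :
    x ∈ reesDeg I n ↔ monomial n ((x : R[X]).coeff n) = (x : R[X]) := by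
  constructor
  · rintro ⟨r, hr⟩
    replace hr : monomial n r = (x : R[X]) := hr
    rw [← hr, coeff_monomial_same]
  · exact fun h ↦ ⟨_, h⟩

variable (I) in
/-- The homogeneous component of degree `n`. -/
def reesComponent (n : ℕ) : reesAlgebra I →+ reesDeg I n where
  toFun x := ⟨⟨monomial n ((x : R[X]).coeff n), reesAlgebra.monomial_mem.mpr (x.2 n)⟩, ⟨_, rfl⟩⟩
  map_zero' := by ext : 2; simp
  map_add' x y := by ext : 2; simp

@[simp]
lemma coe_reesComponent (n : ℕ) (x : reesAlgebra I) :
    ((reesComponent I n x : reesAlgebra I) : R[X]) = monomial n ((x : R[X]).coeff n) := rfl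

instance : SetLike.GradedMonoid (reesDeg I) where
  one_mem := ⟨1, rfl⟩
  mul_mem := by
    rintro i j x y ⟨a, ha⟩ ⟨b, hb⟩
    refine ⟨a * b, ?_⟩
    rw [← monomial_mul_monomial, ha, hb]
    rfl

open scoped DirectSum in
/-- The decomposition of the Rees algebra into its homogeneous parts. -/
def reesDecompose (x : reesAlgebra I) : ⨁ i, reesDeg I i :=
  DirectSum.mk (fun i ↦ reesDeg I i) (x : R[X]).support fun i ↦ reesComponent I i x

lemma reesDecompose_apply (x : reesAlgebra I) (n : ℕ) :
    reesDecompose x n = reesComponent I n x := by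
  by_cases h : n ∈ (x : R[X]).support
  · exact DirectSum.mk_apply_of_mem h
  · rw [reesDecompose, DirectSum.mk_apply_of_notMem h]
    ext : 2
    rw [coe_reesComponent, notMem_support_iff.mp h]
    simp

lemma coeff_coeAddMonoidHom (y : DirectSum ℕ fun i ↦ reesDeg I i) (n : ℕ) :
    (DirectSum.coeAddMonoidHom (reesDeg I) y : R[X]).coeff n = (y n : R[X]).coeff n := by
  induction y using DirectSum.induction_on with
  | zero => simp
  | of i x =>
    rw [DirectSum.coeAddMonoidHom_of]
    obtain rfl | h := eq_or_ne i n
    · rw [DirectSum.of_eq_same]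
    · rw [DirectSum.of_eq_of_ne _ _ _ h.symm, ← mem_reesDeg.mp x.2, coeff_monomial_of_ne _ h.symm]
      simp
  | add x y hx hy => simp [hx, hy]

instance reesGradedAlgebra : GradedAlgebra (reesDeg I) where
  decompose' := reesDecompose
  left_inv x := by
    ext n : 2
    rw [coeff_coeAddMonoidHom, reesDecompose_apply, coe_reesComponent, coeff_monomial_same]
  right_inv y := by
    refine DFinsupp.ext fun n ↦ ?_
    ext : 2
    rw [← mem_reesDeg.mp (y n).2]
    rw [reesDecompose_apply, coe_reesComponent, coeff_coeAddMonoidHom]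

end Grading

variable {R R' : Type u} [CommRing R] [CommRing R']

/-- The graded ring homomorphism between Rees algebras induced by a ring homomorphism that maps
`I` into `J`. -/
def reesMap {I : Ideal R} {J : Ideal R'} (σ : R →+* R') (h : I.map σ ≤ J) :
    reesDeg I →+*ᵍ reesDeg J where
  __ := ((Polynomial.mapRingHom σ).comp (reesAlgebra I).val.toRingHom).codRestrict
    (reesAlgebra J) fun x i ↦ by
      change (Polynomial.map σ (x : R[X])).coeff i ∈ J ^ i
      rw [coeff_map]
      refine Ideal.pow_right_mono h i ?_
      rw [← Ideal.map_pow]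
      exact Ideal.mem_map_of_mem _ (x.2 i)
  map_mem := by
    rintro i x ⟨a, ha⟩
    refine ⟨σ a, ?_⟩
    replace ha : monomial i a = (x : R[X]) := ha
    change _ = Polynomial.map σ (x : R[X])
    rw [← ha, map_monomial]

@[simp]
lemma coe_reesMap {I : Ideal R} {J : Ideal R'} (σ : R →+* R') (h : I.map σ ≤ J)
    (x : reesAlgebra I) : (reesMap σ h x : R'[X]) = Polynomial.map σ (x : R[X]) := rfl

lemma coeff_reesMap {I : Ideal R} {J : Ideal R'} (σ : R →+* R') (h : I.map σ ≤ J)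
    (x : reesAlgebra I) (i : ℕ) :
    (reesMap σ h x : R'[X]).coeff i = σ ((x : R[X]).coeff i) := by
  rw [coe_reesMap, coeff_map]

lemma reesMap_algebraMap {I : Ideal R} {J : Ideal R'} (σ : R →+* R') (h : I.map σ ≤ J)
    (r : R) : reesMap σ h (algebraMap R _ r) = algebraMap R' _ (σ r) := by
  ext : 1
  rw [coe_reesMap]
  exact Polynomial.map_C σ

/-- The Rees algebra commutes with localization. -/
lemma isGradedLocalizationAway_reesMap {I : Ideal R} {J : Ideal R'} (σ : R →+* R')
    (h : I.map σ = J) {f : R} (hσ : letI := σ.toAlgebra; IsLocalization.Away f R') :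
    IsGradedLocalizationAway (reesMap σ h.le) f := by
  let := σ.toAlgebra
  have : IsLocalization.Away f R' := hσ
  have hf : IsUnit (σ f) := IsLocalization.Away.algebraMap_isUnit f
  refine ⟨?_, ?_, ?_⟩
  · rw [reesMap_algebraMap]
    exact hf.map _
  · intro b
    have key : ∀ b : reesAlgebra J, ∀ i, ∃ (n : ℕ) (a : reesAlgebra I),
        reesMap σ h.le (algebraMap R _ f) ^ n * reesComponent J i b = reesMap σ h.le a := by
      intro b i
      have hb : (b : R'[X]).coeff i ∈ (I ^ i).map σ := by
        rw [Ideal.map_pow, h]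
        exact b.2 i
      obtain ⟨⟨⟨a, ha⟩, ⟨_, n, rfl⟩⟩, e⟩ :=
        (IsLocalization.mem_map_algebraMap_iff (.powers f) R').mp hb
      refine ⟨n, ⟨monomial i a, reesAlgebra.monomial_mem.mpr ha⟩, ?_⟩
      ext : 1
      rw [reesMap_algebraMap, ← map_pow, ← Algebra.smul_def, coe_reesMap]
      change σ f ^ n • monomial i ((b : R'[X]).coeff i) = Polynomial.map σ (monomial i a)
      rw [map_monomial, smul_monomial, smul_eq_mul, mul_comm, ← map_pow]
      exact congrArg _ e
    classical
    rw [← DirectSum.sum_support_decompose (reesDeg J) b]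
    refine Finset.sum_induction _ (fun b ↦ ∃ (n : ℕ) (a : reesAlgebra I),
        reesMap σ h.le (algebraMap R _ f) ^ n * b = reesMap σ h.le a) ?_ ?_ ?_
    · rintro a b ⟨n, x, hx⟩ ⟨m, y, hy⟩
      refine ⟨n + m, algebraMap R _ f ^ m * x + algebraMap R _ f ^ n * y, ?_⟩
      rw [map_add, map_mul, map_mul, ← hx, ← hy, map_pow, map_pow]
      ring
    · exact ⟨0, 0, by simp⟩
    · intro i _
      obtain ⟨n, a, e⟩ := key b i
      refine ⟨n, a, ?_⟩
      rw [← e, ← reesDecompose_apply]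
      rfl
  · intro a ha
    have h0 (i : ℕ) : ∃ n : ℕ, f ^ n * (a : R[X]).coeff i = 0 := by
      have h1 := congr(coeff $(congrArg Subtype.val ha) i)
      rw [coe_reesMap, coeff_map] at h1
      obtain ⟨⟨_, n, rfl⟩, hn⟩ := (IsLocalization.map_eq_zero_iff (.powers f) R' _).mp h1
      exact ⟨n, hn⟩
    choose n hn using h0
    refine ⟨(a : R[X]).support.sup n, ?_⟩
    ext i : 2
    rw [← map_pow, ← Algebra.smul_def]
    change (_ • (a : R[X])).coeff i = 0
    rw [coeff_smul, smul_eq_mul]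
    by_cases hi : i ∈ (a : R[X]).support
    · obtain ⟨k, hk⟩ := Nat.exists_eq_add_of_le (Finset.le_sup (f := n) hi)
      rw [hk, add_comm, pow_add, mul_assoc, hn, mul_zero]
    · rw [notMem_support_iff.mp hi, mul_zero]

variable {S : Scheme.{u}}

/-- The ideal of an ideal sheaf over an affine open. -/
abbrev idealOn (I : S.IdealSheafData) (U : S.AffineZariskiSite) : Ideal Γ(S, U.toOpens) :=
  I.ideal ⟨U.toOpens, U.2⟩

/-- The Rees algebra `⨁ₙ Iⁿ` of a quasi-coherent ideal sheaf `I`. -/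
def reesData (I : S.IdealSheafData) : GradedAlgebraData S where
  obj U := reesAlgebra (idealOn I U)
  deg U := reesDeg (idealOn I U)
  res {V U} h := reesMap (S.presheaf.map (homOfLE (toOpens_mono h)).op).hom
    (I.map_ideal (U := ⟨V.toOpens, V.2⟩) (V := ⟨U.toOpens, U.2⟩) (toOpens_mono h)).le
  res_algebraMap h r := reesMap_algebraMap _ _ r
  res_self U a := by
    ext i : 2
    refine (coeff_reesMap _ _ _ _).trans ?_
    exact congr($(S.presheaf.map_id (.op U.toOpens)) ((a : Γ(S, U.toOpens)[X]).coeff i))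
  res_res {W V U} h h' a := by
    ext i : 2
    refine (coeff_reesMap _ _ _ _).trans
      ((congrArg _ (coeff_reesMap _ _ _ _)).trans (Eq.trans ?_ (coeff_reesMap _ _ _ _).symm))
    exact congr($(S.presheaf.map_comp (homOfLE (toOpens_mono h')).op
        (homOfLE (toOpens_mono h)).op) ((a : Γ(S, U.toOpens)[X]).coeff i)).symm
  isLocalization U f := isGradedLocalizationAway_reesMap _
    (I.map_ideal (U := ⟨(U.basicOpen f).toOpens, (U.basicOpen f).2⟩) (V := ⟨U.toOpens, U.2⟩)
      (toOpens_mono (U.basicOpen_le f)))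
    (U.2.isLocalization_basicOpen f)

/-- The blowup `Proj_S ⨁ₙ Iⁿ` of `S` along the closed subscheme defined by the ideal sheaf `I`. -/
def blowup (I : S.IdealSheafData) : Scheme.{u} := (reesData I).relProj

/-- The blowup morphism. -/
def blowupπ (I : S.IdealSheafData) : blowup I ⟶ S := (reesData I).relProjToBase

end Rees

section ZeroLoci

/-- The image of `m` under all linear forms, i.e. the image of the map `M^∨ → R` dual to
`m : R → M`. -/
def imageOfDual {R M : Type*} [CommRing R] [AddCommGroup M] [Module R M] (m : M) : Ideal R :=
  LinearMap.range (Module.Dual.eval R M m)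

section Proj

variable {R A : Type u} [CommRing R] [CommRing A] [Algebra R A] (𝒜 : ℕ → Submodule R A)
  [GradedAlgebra 𝒜]

/-- The sections of the twisting sheaf `𝒪(1)` of `Proj 𝒜` over the basic open `D₊(t)`, where `t` is
homogeneous of degree `d`: the elements of degree one of the `ℤ`-graded ring `A_t`. -/
def twistingSections {d : ℕ} {t : A} (ht : t ∈ 𝒜 d) :
    Submodule (Away 𝒜 t) (Localization.Away t) where
  carrier := { x | ∃ (n : ℕ) (a : A), a ∈ 𝒜 (n * d + 1) ∧
    x = Localization.mk a (⟨t ^ n, n, rfl⟩ : Submonoid.powers t) }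
  zero_mem' := ⟨0, 0, zero_mem _, (Localization.mk_zero _).symm⟩
  add_mem' := by
    rintro _ _ ⟨n, a, ha, rfl⟩ ⟨m, b, hb, rfl⟩
    refine ⟨n + m, t ^ n * b + t ^ m * a, ?_, ?_⟩
    · refine add_mem ?_ ?_
      · convert! SetLike.mul_mem_graded (SetLike.pow_mem_graded n ht) hb using 2
        rw [smul_eq_mul]; ring
      · convert! SetLike.mul_mem_graded (SetLike.pow_mem_graded m ht) ha using 2
        rw [smul_eq_mul]; ring
    · rw [Localization.add_mk]
      exact congrArg (Localization.mk _) (Subtype.ext (pow_add t n m).symm)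
  smul_mem' := by
    rintro c _ ⟨n, a, ha, rfl⟩
    obtain ⟨m, b, hb, rfl⟩ := Away.mk_surjective 𝒜 ht c
    refine ⟨m + n, b * a, ?_, ?_⟩
    · convert! SetLike.mul_mem_graded hb ha using 2
      rw [smul_eq_mul]; ring
    · rw [Algebra.smul_def]
      change (Away.mk 𝒜 ht m b hb).val * _ = _
      rw [Away.val_mk, Localization.mk_mul]
      exact congrArg (Localization.mk _) (Subtype.ext (pow_add t m n).symm)

/-- The restriction to `D₊(t)` of the global section of `𝒪(1)` defined by `s ∈ A₁`. -/
def twistingSection {s : A} (hs : s ∈ 𝒜 1) {d : ℕ} {t : A} (ht : t ∈ 𝒜 d) :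
    twistingSections 𝒜 ht :=
  ⟨Localization.mk s 1, 0, s, by simpa using hs,
    congrArg (Localization.mk s) (Subtype.ext (pow_zero t).symm)⟩

/-- The ideal sheaf of the zero locus of the section of `𝒪(1)` on `Proj 𝒜` defined by `s ∈ A₁`:
it is generated by the images of the maps `𝒪(1)^∨ → 𝒪` dual to this section over the
affine opens `D₊(t)`. -/
def projZeroIdeal {s : A} (hs : s ∈ 𝒜 1) : (Proj 𝒜).IdealSheafData :=
  sInf { J | ∀ (d : ℕ) (hd : 0 < d) (t : A) (ht : t ∈ 𝒜 d),
    (imageOfDual (R := Away 𝒜 t) (twistingSection 𝒜 hs ht)).map (Proj.awayToSection 𝒜 t).hom ≤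
      J.ideal ⟨Proj.basicOpen 𝒜 t, Proj.isAffineOpen_basicOpen 𝒜 t ht hd⟩ }

end Proj

variable {S : Scheme.{u}} (E : S.Modules)

/-- The sections `e₁, …, e_r` of `E` over `U` form a frame: they induce an isomorphism
`𝒪_U^r ≅ E|_U`. -/
def IsFrame {U : S.Opens} {r : ℕ} (e : Fin r → Γ(E, U)) : Prop :=
  ∀ (V : S.Opens) (h : V ≤ U),
    LinearIndependent Γ(S, V) (fun i ↦ moduleRes E h (e i)) ∧
      Submodule.span Γ(S, V) (Set.range fun i ↦ moduleRes E h (e i)) = ⊤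

/-- `E` has rank `r`: locally it has frames of length `r`. -/
def HasRank (r : ℕ) : Prop :=
  ∀ x : S, ∃ (U : S.Opens) (_ : x ∈ U) (e : Fin r → Γ(E, U)), IsFrame E e

variable {E}

/-- The ideal sheaf of the zero locus `s⁻¹(0)` of a section `s` of a vector bundle `E`: the image
of the map `E^∨ → 𝒪_S` dual to `s`. -/
def zeroIdeal (s : Γ(E, ⊤)) : S.IdealSheafData :=
  .ofIdeals fun U ↦ imageOfDual (R := Γ(S, U.1)) (moduleRes E (le_top : U.1 ≤ ⊤) s)

/-- A section `s` of a vector bundle of rank `r` is regular if at each point `x` of its zero locus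
its components `c₁, …, c_r` with respect to a frame of `E` near `x` form a regular
sequence in the local ring at `x`. (On a locally Noetherian scheme this does not depend on
the frame.) -/
def IsRegularSection (r : ℕ) (s : Γ(E, ⊤)) : Prop :=
  ∀ x ∈ (zeroIdeal s).support, ∃ (U : S.Opens) (hx : x ∈ U) (e : Fin r → Γ(E, U))
    (c : Fin r → Γ(S, U)), IsFrame E e ∧ moduleRes E le_top s = ∑ i, c i • e i ∧
      RingTheory.Sequence.IsRegular (S.presheaf.stalk x)
        (List.ofFn fun i ↦ S.presheaf.germ U x hx (c i))

/-- Locally free modules are quasi-coherent. -/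
instance isQuasicoherent_of_isLocallyFree (E : S.Modules)
    [SheafOfModules.IsLocallyFree (R := S.ringCatSheaf) E] :
    SheafOfModules.IsQuasicoherent (R := S.ringCatSheaf) E := by
  exact SheafOfModules.instIsQuasicoherentOfIsLocallyFree (R := S.ringCatSheaf) E

variable (E) [SheafOfModules.IsQuasicoherent (R := S.ringCatSheaf) E]

/-- The projective bundle `ℙE^∨ = Proj_S (Sym E)` of lines in the fibres of `E^∨`. -/
def projBundle : Scheme.{u} := (symAlgebra E).relProj

/-- The bundle projection `ℙE^∨ ⟶ S`. -/
def projBundleπ : projBundle E ⟶ S := (symAlgebra E).relProjToBase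

variable {E}

/-- The ideal sheaf of the zero locus `w⁻¹(0)` in `ℙE^∨` of the section `w` of `𝒪(1)` which
corresponds to the section `s` of `E`, i.e. the composition of `s : 𝒪 → q^*E` with the canonical
map `q^*E → 𝒪(1)`. Over an affine open `U` of `S`, where `ℙE^∨` is `Proj` of the symmetric algebra
of `Γ(E, U)`, the section `w` is given by the element `s|_U` of degree one. -/
def projBundleZeroIdeal (s : Γ(E, ⊤)) : (projBundle E).IdealSheafData :=
  sInf { J | ∀ U : S.AffineZariskiSite,
    projZeroIdeal (symDeg Γ(S, U.toOpens) Γ(E, U.toOpens))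
      (ι_mem_symDeg (moduleRes E (le_top : U.toOpens ≤ ⊤) s)) ≤
        J.comap ((symAlgebra E).projι U) }

end ZeroLoci

end SectionBlowup

end

open SectionBlowup

/-! In a local frame write s = a e₀ + b e₁. The linear form x ↦ x ∧ s sends e₀ to b and e₁ to -a, so
it maps E onto I_Y = (a, b). It extends to a graded surjection Sym E → ⨁ₙ Iⁿ
(`symToRees_surjective`), and Proj of this is a closed immersion of the local blowup into ℙE^∨. When
a, b is a regular sequence, every homogeneous element of the kernel is a multiple of s
(`dvd_of_symToRees_eq_zero`): the Rees algebra has the single relation a e₀ + b e₁. On the charts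
D₊(t) the multiples of s give exactly the ideal of the zero locus of w
(`ker_awayMap_le_imageOfDual`, `imageOfDual_le_ker_awayMap`), so the closed immersion identifies the
local blowup with X.

Globally x ∧ s takes values in det E, so the graded homomorphism depends on the frame: a change of
frame with determinant u multiplies it by uⁿ in degree n. Proj does not see this twist
(`projMap_eq_of_eq_mul_pow`), so the closed immersions glue although the homomorphisms do not.

Suitable charts exist around every point (`exists_regularChart`): on Y regularity of the germs
spreads to a neighbourhood because S is locally Noetherian, and off Y one component of s is
invertible. The glued closed immersion Bl_Y S → ℙE^∨ has the ideal sheaf of X as its kernel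
(`ker_glue_eq`), and two closed immersions with the same kernel are isomorphic over the target. -/

noncomputable section

namespace SectionBlowup

open Limits HomogeneousLocalization

/-! ### The zero locus of a degree-one element on the charts D₊(t). -/

section ProjZeroLocus

variable {R R' A B : Type u} [CommRing R] [CommRing R'] [CommRing A] [CommRing B]
  [Algebra R A] [Algebra R' B] {𝒜 : ℕ → Submodule R A} {ℬ : ℕ → Submodule R' B}
  [GradedAlgebra 𝒜] [GradedAlgebra ℬ]

lemma irrelevant_le_map_of_surjective (φ : 𝒜 →+*ᵍ ℬ) (hφ : Function.Surjective φ) :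
    HomogeneousIdeal.irrelevant ℬ ≤ (HomogeneousIdeal.irrelevant 𝒜).map φ := by
  classical
  intro b hb
  change b ∈ (HomogeneousIdeal.irrelevant ℬ).toIdeal at hb
  change b ∈ (HomogeneousIdeal.irrelevant 𝒜).toIdeal.map φ
  rw [← DirectSum.sum_support_decompose ℬ b]
  refine Ideal.sum_mem _ fun i _ ↦ ?_
  rcases Nat.eq_zero_or_pos i with rfl | hi
  · convert! Ideal.zero_mem _
  obtain ⟨a, rfl⟩ := hφ b
  rw [← φ.map_directSumDecompose]
  exact Ideal.mem_map_of_mem _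
    (HomogeneousIdeal.mem_irrelevant_of_mem 𝒜 hi (SetLike.coe_mem (DirectSum.decompose 𝒜 a i)))

lemma awayMap_surjective {φ : 𝒜 →+*ᵍ ℬ} (hφ : Function.Surjective φ) {d : ℕ} {t : A}
    (ht : t ∈ 𝒜 d) : Function.Surjective (Away.map φ t) := by
  intro z
  obtain ⟨n, b, hb, rfl⟩ := Away.mk_surjective ℬ (Graded.map_mem φ ht) z
  obtain ⟨a, rfl⟩ := hφ b
  have h : φ (DirectSum.decompose 𝒜 a (n • d) : A) = φ a := by
    rw [φ.map_directSumDecompose, DirectSum.decompose_of_mem_same ℬ hb]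
  refine ⟨Away.mk 𝒜 ht n _ (SetLike.coe_mem (DirectSum.decompose 𝒜 a (n • d))), ?_⟩
  rw [Away.map_mk]
  ext
  rw [Away.val_mk, Away.val_mk, h]

lemma awayMap_mk_eq_zero_iff {φ : 𝒜 →+*ᵍ ℬ} {d : ℕ} {t : A} (ht : t ∈ 𝒜 d) (n : ℕ) (a : A)
    (ha : a ∈ 𝒜 (n • d)) :
    Away.map φ t (Away.mk 𝒜 ht n a ha) = 0 ↔ ∃ k : ℕ, φ (t ^ k * a) = 0 := by
  rw [Away.map_mk, HomogeneousLocalization.ext_iff_val, Away.val_mk, val_zero, Localization.mk_eq_mk',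
    IsLocalization.mk'_eq_zero_iff]
  constructor
  · rintro ⟨⟨_, k, rfl⟩, h⟩
    exact ⟨k, by simpa using h⟩
  · rintro ⟨k, h⟩
    exact ⟨⟨_, k, rfl⟩, by simpa using h⟩

/-- Multiplication by `c / tᴺ`, of degree `-1`, as a linear form on the sections of `𝒪(1)` over
`D₊(t)`. -/
lemma exists_twistingSections_dual {d : ℕ} {t : A} (ht : t ∈ 𝒜 d) {c : A} {e N : ℕ}
    (hc : c ∈ 𝒜 e) (he : e + 1 = N * d) :
    ∃ μ : Module.Dual (Away 𝒜 t) (twistingSections 𝒜 ht), ∀ x, (μ x).val =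
      Localization.mk c (⟨t ^ N, N, rfl⟩ : Submonoid.powers t) * (x : Localization.Away t) := by
  let L : Localization.Away t →ₗ[Away 𝒜 t] Localization.Away t :=
    LinearMap.mulLeft (Away 𝒜 t) (Localization.mk c (⟨t ^ N, N, rfl⟩ : Submonoid.powers t))
  let V : Away 𝒜 t →ₗ[Away 𝒜 t] Localization.Away t := Algebra.linearMap _ _
  have hV : Function.Injective V := HomogeneousLocalization.val_injective _
  have hL (x : twistingSections 𝒜 ht) : L x ∈ LinearMap.range V := by
    obtain ⟨_, n, a, ha, rfl⟩ := x
    refine ⟨Away.mk 𝒜 ht (N + n) (c * a) ?_, ?_⟩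
    · convert! SetLike.mul_mem_graded hc ha using 2
      rw [smul_eq_mul, add_mul, ← he]; ring
    · change (Away.mk 𝒜 ht _ _ _).val = Localization.mk _ _ * Localization.mk _ _
      rw [Away.val_mk, Localization.mk_mul]
      exact congrArg (Localization.mk _) (Subtype.ext (pow_add t N n))
  refine ⟨(LinearEquiv.ofInjective V hV).symm.toLinearMap ∘ₗ
    (L.comp (twistingSections 𝒜 ht).subtype).codRestrict _ hL, fun x ↦ ?_⟩
  exact congrArg Subtype.val ((LinearEquiv.ofInjective V hV).apply_symm_apply ⟨L x, hL x⟩)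

/-- If a / tⁿ dies in the target, some multiple tᵏ⁺¹ a is s c. Then a / tⁿ is the value at s of the
linear form "multiply by c / tᴺ" with N = k + 1 + n. -/
lemma ker_awayMap_le_imageOfDual {φ : 𝒜 →+*ᵍ ℬ} {s : A} (hs : s ∈ 𝒜 1)
    (hker : ∀ (n : ℕ) (x : A), x ∈ 𝒜 n → φ x = 0 → s ∣ x) {d : ℕ} (hd : 0 < d) {t : A}
    (ht : t ∈ 𝒜 d) :
    RingHom.ker (Away.map φ t) ≤ imageOfDual (R := Away 𝒜 t) (twistingSection 𝒜 hs ht) := by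
  intro z hz
  obtain ⟨n, a, ha, rfl⟩ := Away.mk_surjective 𝒜 ht z
  obtain ⟨k, hk⟩ := (awayMap_mk_eq_zero_iff ht n a ha).mp hz
  -- The exponent k + 1 instead of k makes this degree positive, so that a degree e one lower exists
  -- for the cofactor.
  have hmem : t ^ (k + 1) * a ∈ 𝒜 ((k + 1 + n) * d) := by
    convert! SetLike.mul_mem_graded (SetLike.pow_mem_graded (k + 1) ht) ha using 2
    rw [smul_eq_mul, smul_eq_mul]; ring
  obtain ⟨c, hc⟩ := hker _ _ hmem (by rw [pow_succ', mul_assoc, map_mul, hk, mul_zero])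
  obtain ⟨e, he⟩ : ∃ e, e + 1 = (k + 1 + n) * d :=
    ⟨(k + 1 + n) * d - 1, Nat.sub_add_cancel (Nat.mul_pos (by lia) hd)⟩
  -- The cofactor c need not be homogeneous. Comparing components shows that its part of degree e
  -- suffices.
  have hc' : t ^ (k + 1) * a = s * (DirectSum.decompose 𝒜 c e : A) := by
    rw [← he, add_comm] at hmem
    rw [← DirectSum.coe_decompose_mul_add_of_left_mem 𝒜 hs, ← hc,
      DirectSum.decompose_of_mem_same 𝒜 hmem]
  obtain ⟨μ, hμ⟩ := exists_twistingSections_dual ht (SetLike.coe_mem (DirectSum.decompose 𝒜 c e)) he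
  refine ⟨μ, ?_⟩
  ext
  change (μ (twistingSection 𝒜 hs ht)).val = _
  rw [hμ, Away.val_mk]
  change Localization.mk _ _ * Localization.mk s 1 = _
  rw [Localization.mk_mul, Localization.mk_eq_mk_iff, Localization.r_iff_exists]
  refine ⟨1, ?_⟩
  simp only [OneMemClass.coe_one, one_mul, mul_one]
  rw [mul_comm _ s, ← hc']
  ring

/-- An arbitrary linear form μ on the sections of 𝒪(1) is not given as multiplication by a fraction.
Generation in degree one replaces this: t is a sum of products v z with v of degree 1, and linearity
gives (v z / t) μ(s) = (s z / t) μ(v), which φ kills. Summing, the coefficients v z / t add up to 1.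
-/
lemma imageOfDual_le_ker_awayMap {φ : 𝒜 →+*ᵍ ℬ} {s : A} (hs : s ∈ 𝒜 1) (hφ : φ s = 0)
    (hgen : ∀ n, 𝒜 (n + 1) ≤ 𝒜 1 * 𝒜 n) {d : ℕ} (hd : 0 < d) {t : A} (ht : t ∈ 𝒜 d) :
    imageOfDual (R := Away 𝒜 t) (twistingSection 𝒜 hs ht) ≤ RingHom.ker (Away.map φ t) := by
  rintro _ ⟨μ, rfl⟩
  change Away.map φ t (μ (twistingSection 𝒜 hs ht)) = 0
  set y := μ (twistingSection 𝒜 hs ht) with hy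
  obtain ⟨e, rfl⟩ := Nat.exists_eq_succ_of_ne_zero hd.ne'
  have hd' : e + 1 = 1 • (e + 1) := (one_smul _ _).symm
  have key (w : A) (hw : w ∈ 𝒜 1 * 𝒜 e) : ∃ hw' : w ∈ 𝒜 (1 • (e + 1)),
      Away.map φ t (Away.mk 𝒜 ht 1 w hw' * y) = 0 := by
    induction hw using Submodule.mul_induction_on' with
    | mem_mul_mem v hv z hz =>
      have hvz : v * z ∈ 𝒜 (1 • (e + 1)) := by
        rw [one_smul, add_comm]; exact SetLike.mul_mem_graded hv hz
      have hsz : s * z ∈ 𝒜 (1 • (e + 1)) := by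
        rw [one_smul, add_comm]; exact SetLike.mul_mem_graded hs hz
      refine ⟨hvz, ?_⟩
      -- The roles of v and s are exchanged, so that μ is evaluated at v and the factor s moves into
      -- the scalar.
      have h1 : Away.mk 𝒜 ht 1 (v * z) hvz • twistingSection 𝒜 hs ht =
          Away.mk 𝒜 ht 1 (s * z) hsz • twistingSection 𝒜 hv ht := by
        ext
        change (Away.mk 𝒜 ht 1 (v * z) hvz).val * Localization.mk s 1 =
          (Away.mk 𝒜 ht 1 (s * z) hsz).val * Localization.mk v 1
        rw [Away.val_mk, Away.val_mk, Localization.mk_mul, Localization.mk_mul]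
        congr 1
        ring
      have h2 := congrArg μ h1
      rw [map_smul, map_smul, ← hy, smul_eq_mul, smul_eq_mul] at h2
      rw [h2, map_mul, (awayMap_mk_eq_zero_iff ht 1 _ hsz).mpr ⟨0, by simp [hφ]⟩, zero_mul]
    | add v _ w _ ihv ihw =>
      obtain ⟨hv, hv'⟩ := ihv
      obtain ⟨hw, hw'⟩ := ihw
      refine ⟨add_mem hv hw, ?_⟩
      have h3 : Away.mk 𝒜 ht 1 (v + w) (add_mem hv hw) =
          Away.mk 𝒜 ht 1 v hv + Away.mk 𝒜 ht 1 w hw := by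
        ext
        rw [val_add, Away.val_mk, Away.val_mk, Away.val_mk, Localization.add_mk_self]
      rw [h3, add_mul, map_add, hv', hw', add_zero]
  obtain ⟨hw', h⟩ := key t (hgen e ht)
  have h1 : Away.mk 𝒜 ht 1 t hw' = 1 := by
    ext
    rw [Away.val_mk, val_one]
    exact (Localization.mk_eq_mk_iff.mpr (Localization.r_iff_exists.mpr ⟨1, by simp⟩)).trans
      Localization.mk_one
  rwa [h1, one_mul] at h

end ProjZeroLocus

/-! ### Morphisms of homogeneous spectra: closed immersions, kernels, rescaling. -/

section ProjMap

variable {R R' A B : Type u} [CommRing R] [CommRing R'] [CommRing A] [CommRing B]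
  [Algebra R A] [Algebra R' B] {𝒜 : ℕ → Submodule R A} {ℬ : ℕ → Submodule R' B}
  [GradedAlgebra 𝒜] [GradedAlgebra ℬ]

lemma iSup_proj_basicOpen (𝒜 : ℕ → Submodule R A) [GradedAlgebra 𝒜] :
    ⨆ s : (Σ i : ℕ+, 𝒜 i), Proj.basicOpen 𝒜 (s.2 : A) = ⊤ := by
  rw [← Scheme.OpenCover.iSup_opensRange (Proj.affineOpenCover 𝒜).openCover]
  exact iSup_congr fun s ↦ (Proj.opensRange_awayι 𝒜 (s.2 : A) s.2.2 s.1.2).symm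

lemma awayToSection_bijective {d : ℕ} (hd : 0 < d) {t : A} (ht : t ∈ 𝒜 d) :
    Function.Bijective (Proj.awayToSection 𝒜 t) :=
  ConcreteCategory.bijective_of_isIso (Proj.basicOpenIsoAway 𝒜 t ht hd).hom

lemma projMap_app_awayToSection (φ : 𝒜 →+*ᵍ ℬ)
    (h : HomogeneousIdeal.irrelevant ℬ ≤ (HomogeneousIdeal.irrelevant 𝒜).map φ) {d : ℕ} {t : A}
    (ht : t ∈ 𝒜 d) (y : Away 𝒜 t) :
    (Proj.map φ h).app (Proj.basicOpen 𝒜 t) (Proj.awayToSection 𝒜 t y) =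
      Proj.awayToSection ℬ (φ t) (Away.map φ t y) := by
  have e := Proj.awayToSection_comp_appLE φ h ht
  rw [show (Proj.map φ h).appLE (Proj.basicOpen 𝒜 t) (Proj.basicOpen ℬ (φ t)) (by rfl) =
    (Proj.map φ h).app (Proj.basicOpen 𝒜 t) from Scheme.Hom.appLE_eq_app _] at e
  exact congr($e y)

instance isAffineHom_projMap (φ : 𝒜 →+*ᵍ ℬ)
    (h : HomogeneousIdeal.irrelevant ℬ ≤ (HomogeneousIdeal.irrelevant 𝒜).map φ) :
    IsAffineHom (Proj.map φ h) :=
  isAffineHom_of_forall_exists_isAffineOpen _ fun x ↦ by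
    obtain ⟨s, hs⟩ := TopologicalSpace.Opens.mem_iSup.mp
      ((iSup_proj_basicOpen 𝒜).ge (TopologicalSpace.Opens.mem_top x))
    exact ⟨_, hs, Proj.isAffineOpen_basicOpen 𝒜 _ s.2.2 s.1.pos,
      Proj.isAffineOpen_basicOpen ℬ _ (Graded.map_mem φ s.2.2) s.1.pos⟩

lemma mem_ker_projMap_iff (φ : 𝒜 →+*ᵍ ℬ)
    (h : HomogeneousIdeal.irrelevant ℬ ≤ (HomogeneousIdeal.irrelevant 𝒜).map φ) {d : ℕ}
    (hd : 0 < d) {t : A} (ht : t ∈ 𝒜 d) (y : Away 𝒜 t) :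
    Proj.awayToSection 𝒜 t y ∈ (Proj.map φ h).ker.ideal
      ⟨Proj.basicOpen 𝒜 t, Proj.isAffineOpen_basicOpen 𝒜 t ht hd⟩ ↔ Away.map φ t y = 0 := by
  rw [Scheme.Hom.ker_apply, RingHom.mem_ker]
  change (Proj.map φ h).app (Proj.basicOpen 𝒜 t) (Proj.awayToSection 𝒜 t y) = 0 ↔ _
  rw [projMap_app_awayToSection φ h ht]
  exact map_eq_zero_iff (Proj.awayToSection ℬ (φ t)).hom
    (awayToSection_bijective hd (Graded.map_mem φ ht)).1

lemma isClosedImmersion_projMap (φ : 𝒜 →+*ᵍ ℬ) (hφ : Function.Surjective φ) :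
    IsClosedImmersion (Proj.map φ (irrelevant_le_map_of_surjective φ hφ)) := by
  rw [IsZariskiLocalAtTarget.iff_of_iSup_eq_top (P := @IsClosedImmersion) _ (iSup_proj_basicOpen 𝒜)]
  intro s
  have : IsAffine (Proj.basicOpen 𝒜 (s.2 : A)).toScheme :=
    Proj.isAffineOpen_basicOpen 𝒜 _ s.2.2 s.1.pos
  have : IsAffine (Proj.map φ (irrelevant_le_map_of_surjective φ hφ) ⁻¹ᵁ
      Proj.basicOpen 𝒜 (s.2 : A)).toScheme :=
    Proj.isAffineOpen_basicOpen ℬ _ (Graded.map_mem φ s.2.2) s.1.pos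
  refine IsClosedImmersion.of_surjective_of_isAffine _ ?_
  have h (V : (Proj 𝒜).Opens) (hV : V = Proj.basicOpen 𝒜 (s.2 : A)) :
      Function.Surjective ((Proj.map φ (irrelevant_le_map_of_surjective φ hφ)).app V) := by
    subst hV
    intro x
    obtain ⟨y, rfl⟩ := (awayToSection_bijective s.1.pos (Graded.map_mem φ s.2.2)).2 x
    obtain ⟨z, rfl⟩ := awayMap_surjective hφ s.2.2 y
    exact ⟨_, projMap_app_awayToSection φ _ s.2.2 z⟩
  rw [morphismRestrict_appTop]
  exact (ConcreteCategory.bijective_of_isIso ((Proj ℬ).presheaf.map _)).2.comp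
    (h _ (by simp))

/-- `projZeroIdeal` is an infimum, so it suffices that the kernel is one of the competing ideal
sheaves. -/
lemma projZeroIdeal_le_ker (φ : 𝒜 →+*ᵍ ℬ)
    (h : HomogeneousIdeal.irrelevant ℬ ≤ (HomogeneousIdeal.irrelevant 𝒜).map φ)
    (hgen : ∀ n, 𝒜 (n + 1) ≤ 𝒜 1 * 𝒜 n) {s : A} (hs : s ∈ 𝒜 1) (hφ : φ s = 0) :
    projZeroIdeal 𝒜 hs ≤ (Proj.map φ h).ker := by
  refine sInf_le fun d hd t ht ↦ Ideal.map_le_iff_le_comap.mpr fun y hy ↦ ?_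
  exact (mem_ker_projMap_iff φ h hd ht y).mpr (imageOfDual_le_ker_awayMap hs hφ hgen hd ht hy)

/-- Every competitor J in the infimum contains the image of the dual over each D₊(t), and these
opens cover Proj. -/
lemma ker_le_projZeroIdeal (φ : 𝒜 →+*ᵍ ℬ)
    (h : HomogeneousIdeal.irrelevant ℬ ≤ (HomogeneousIdeal.irrelevant 𝒜).map φ)
    {s : A} (hs : s ∈ 𝒜 1) (hker : ∀ (n : ℕ) (x : A), x ∈ 𝒜 n → φ x = 0 → s ∣ x) :
    (Proj.map φ h).ker ≤ projZeroIdeal 𝒜 hs := by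
  refine le_sInf fun J hJ ↦ Scheme.IdealSheafData.le_of_iSup_eq_top
    (fun s : (Σ i : ℕ+, 𝒜 i) ↦ ⟨Proj.basicOpen 𝒜 (s.2 : A),
      Proj.isAffineOpen_basicOpen 𝒜 _ s.2.2 s.1.pos⟩) (iSup_proj_basicOpen 𝒜) fun t x hx ↦ ?_
  obtain ⟨y, rfl⟩ := (awayToSection_bijective t.1.pos t.2.2).2 x
  exact Ideal.map_le_iff_le_comap.mp (hJ _ t.1.pos _ t.2.2)
    (ker_awayMap_le_imageOfDual hs hker t.1.pos t.2.2
      ((mem_ker_projMap_iff φ h t.1.pos t.2.2 y).mp hx))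

/-- Graded homomorphisms which differ by powers of a unit of degree zero induce the same morphism
between homogeneous spectra. -/
lemma projMap_eq_of_eq_mul_pow (φ ψ : 𝒜 →+*ᵍ ℬ)
    (h : HomogeneousIdeal.irrelevant ℬ ≤ (HomogeneousIdeal.irrelevant 𝒜).map φ)
    (h' : HomogeneousIdeal.irrelevant ℬ ≤ (HomogeneousIdeal.irrelevant 𝒜).map ψ)
    {u : B} (hu : u ∈ ℬ 0)
    (e : ∀ (n : ℕ) (x : A), x ∈ 𝒜 n → ψ x = φ x * u ^ n) : Proj.map φ h = Proj.map ψ h' := by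
  refine (Proj.mapAffineOpenCover _ h').openCover.hom_ext _ _ ?_
  rintro (s : Σ i : ℕ+, 𝒜 i)
  change Proj.awayι ℬ (ψ s.2) (Graded.map_mem ψ s.2.2) s.1.2 ≫ _ =
    Proj.awayι ℬ (ψ s.2) (Graded.map_mem ψ s.2.2) s.1.2 ≫ _
  have hud : u ^ (s.1 : ℕ) ∈ ℬ 0 := by simpa using SetLike.pow_mem_graded s.1 hu
  -- Since ψ(s) = φ(s) u^deg(s), the chart of ψ(s) factors through that of φ(s). Both morphisms are
  -- therefore given there by ring maps out of the same `Away 𝒜 s`.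
  have e1 := Proj.SpecMap_awayMap_awayι ℬ (Graded.map_mem φ s.2.2) s.1.pos hud (e _ s.2 s.2.2)
  have e2 := congr($e1 ≫ Proj.map φ h)
  rw [Category.assoc, Proj.awayι_comp_map φ h s.1.pos _ s.2.2, ← Spec.map_comp_assoc] at e2
  refine e2.symm.trans (Eq.trans ?_ (Proj.awayι_comp_map ψ h' s.1.pos _ s.2.2).symm)
  congr 2
  ext z
  obtain ⟨n, a, ha, rfl⟩ := Away.mk_surjective 𝒜 s.2.2 z
  simp only [CommRingCat.hom_comp, CommRingCat.hom_ofHom, RingHom.comp_apply]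
  rw [Away.map_mk, Away.map_mk, awayMap_mk, Away.val_mk,
    Away.val_mk]
  congr 1
  -- The numerator of a / sⁿ has degree n deg(s), so it acquires the same power of u as the
  -- denominator.
  rw [e _ a ha, smul_eq_mul, ← pow_mul, mul_comm n]

end ProjMap

/-! ### The map from the symmetric algebra to the Rees algebra and its kernel. -/

section SymToRees

open Polynomial

variable {R R' M M' : Type u} [CommRing R] [CommRing R'] [AddCommGroup M] [Module R M]
  [AddCommGroup M'] [Module R' M']

lemma symDeg_succ_le (n : ℕ) : symDeg R M (n + 1) ≤ symDeg R M 1 * symDeg R M n := by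
  rw [symDeg, symDeg, symDeg, pow_one, pow_succ']

/-- The homomorphism `Sym M → ⨁ₙ Iⁿ` induced by a linear map `M → I`. -/
def symToReesAlgHom (I : Ideal R) (θ : M →ₗ[R] R) (h : LinearMap.range θ ≤ I) :
    SymmetricAlgebra R M →ₐ[R] reesAlgebra I :=
  SymmetricAlgebra.lift
    { toFun m := ⟨monomial 1 (θ m), reesAlgebra.monomial_mem.mpr
        (by rw [pow_one]; exact h (LinearMap.mem_range_self θ m))⟩
      map_add' x y := by ext : 1; simp
      map_smul' r x := by
        ext : 1
        simp only [map_smul]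
        rfl }

lemma coe_symToReesAlgHom_ι {I : Ideal R} {θ : M →ₗ[R] R} (h : LinearMap.range θ ≤ I) (m : M) :
    (symToReesAlgHom I θ h (SymmetricAlgebra.ι R M m) : R[X]) = monomial 1 (θ m) := by
  rw [symToReesAlgHom, SymmetricAlgebra.lift_ι_apply]
  rfl

/-- The graded homomorphism `Sym M → ⨁ₙ Iⁿ` induced by a linear map `M → I`. -/
def symToRees (I : Ideal R) (θ : M →ₗ[R] R) (h : LinearMap.range θ ≤ I) :
    symDeg R M →+*ᵍ reesDeg I where
  __ := (symToReesAlgHom I θ h).toRingHom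
  map_mem := by
    intro i x hx
    change x ∈ LinearMap.range (SymmetricAlgebra.ι R M) ^ i at hx
    change symToReesAlgHom I θ h x ∈ _
    induction hx using Submodule.pow_induction_on_left' with
    | algebraMap r =>
      rw [AlgHom.commutes]
      exact SetLike.algebraMap_mem_graded (reesDeg I) _
    | add x y i hx hy ihx ihy =>
      rw [map_add]
      exact add_mem ihx ihy
    | mem_mul m hm i x hx ih =>
      obtain ⟨m, rfl⟩ := hm
      rw [map_mul, Nat.succ_eq_add_one, add_comm]
      exact SetLike.mul_mem_graded ⟨θ m, (coe_symToReesAlgHom_ι h m).symm⟩ ih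

variable {I : Ideal R} {θ : M →ₗ[R] R} (h : LinearMap.range θ ≤ I)

lemma symToRees_algebraMap (r : R) : symToRees I θ h (algebraMap R _ r) = algebraMap R _ r :=
  (symToReesAlgHom I θ h).commutes r

lemma coe_symToRees_ι (m : M) :
    (symToRees I θ h (SymmetricAlgebra.ι R M m) : R[X]) = monomial 1 (θ m) :=
  coe_symToReesAlgHom_ι h m

/-- The Rees algebra is generated over R by its degree-one part I t, which θ hits. -/
lemma symToRees_surjective (h : LinearMap.range θ = I) :
    Function.Surjective (symToRees I θ h.le) := by
  intro y
  suffices H : ∀ f ∈ Algebra.adjoin R (Submodule.map (monomial 1 : R →ₗ[R] R[X]) I : Set R[X]),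
      ∃ x, (symToRees I θ h.le x : R[X]) = f by
    obtain ⟨x, hx⟩ := H y (by rw [adjoin_monomial_eq_reesAlgebra]; exact y.2)
    exact ⟨x, Subtype.ext hx⟩
  intro f hf
  induction hf using Algebra.adjoin_induction with
  | mem f hf =>
    obtain ⟨r, hr, rfl⟩ := hf
    rw [SetLike.mem_coe, ← h] at hr
    obtain ⟨m, rfl⟩ := hr
    exact ⟨_, coe_symToRees_ι h.le m⟩
  | algebraMap r => exact ⟨algebraMap R _ r, congrArg Subtype.val (symToRees_algebraMap h.le r)⟩
  | add f g _ _ hf hg =>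
    obtain ⟨x, hx⟩ := hf
    obtain ⟨y, hy⟩ := hg
    exact ⟨x + y, by rw [map_add, ← hx, ← hy]; rfl⟩
  | mul f g _ _ hf hg =>
    obtain ⟨x, hx⟩ := hf
    obtain ⟨y, hy⟩ := hg
    exact ⟨x * y, by rw [map_mul, ← hx, ← hy]; rfl⟩

/-- Rescaling `θ` by `u` multiplies the homomorphism by `uⁿ` in degree `n`. -/
lemma symToRees_smul {θ' : M →ₗ[R] R} (h' : LinearMap.range θ' ≤ I) (u : R)
    (e : ∀ m, θ' m = u * θ m) {n : ℕ} {x : SymmetricAlgebra R M} (hx : x ∈ symDeg R M n) :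
    symToRees I θ' h' x = symToRees I θ h x * algebraMap R (reesAlgebra I) u ^ n := by
  change x ∈ LinearMap.range (SymmetricAlgebra.ι R M) ^ n at hx
  induction hx using Submodule.pow_induction_on_left' with
  | algebraMap r => rw [symToRees_algebraMap, symToRees_algebraMap, pow_zero, mul_one]
  | add x y i hx hy ihx ihy => rw [map_add, map_add, ihx, ihy, add_mul]
  | mem_mul m hm i x hx ih =>
    obtain ⟨m, rfl⟩ := hm
    have : symToRees I θ' h' (SymmetricAlgebra.ι R M m) =
        symToRees I θ h (SymmetricAlgebra.ι R M m) * algebraMap R (reesAlgebra I) u := by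
      ext : 1
      change _ = (symToRees I θ h (SymmetricAlgebra.ι R M m) : R[X]) * Polynomial.C u
      rw [coe_symToRees_ι, coe_symToRees_ι, e, monomial_mul_C, mul_comm]
    rw [map_mul, map_mul, ih, this, pow_succ]
    ring

/-- Naturality of `symToRees`. -/
lemma reesMap_comp_symToRees {J : Ideal R'} {σ : R →+* R'} (hσ : I.map σ ≤ J) {g : M →ₛₗ[σ] M'}
    {θ' : M' →ₗ[R'] R'} (h' : LinearMap.range θ' ≤ J) (e : ∀ m, σ (θ m) = θ' (g m)) :
    (reesMap σ hσ).comp (symToRees I θ h) = (symToRees J θ' h').comp (symMap g) := by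
  refine GradedRingHom.ext fun x ↦ RingHom.congr_fun
    (f := ((reesMap σ hσ).comp (symToRees I θ h)).toRingHom)
    (g := ((symToRees J θ' h').comp (symMap g)).toRingHom)
    (sym_ringHom_ext (fun r ↦ ?_) fun m ↦ ?_) x
  · change reesMap σ hσ (symToRees I θ h _) = symToRees J θ' h' (symMap g _)
    rw [symToRees_algebraMap, reesMap_algebraMap, symMap_algebraMap, symToRees_algebraMap]
  · change reesMap σ hσ (symToRees I θ h _) = symToRees J θ' h' (symMap g _)
    ext : 1
    rw [coe_reesMap, symMap_ι, coe_symToRees_ι, coe_symToRees_ι, Polynomial.map_monomial, e]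

/-- A homogeneous element of `Sym M` is a monomial in the first generator modulo the second. -/
lemma symDeg_succ_eq_pow_add_mul {e₀ e₁ : M} (he : Submodule.span R {e₀, e₁} = ⊤) {n : ℕ}
    {x : SymmetricAlgebra R M} (hx : x ∈ symDeg R M n) :
    ∃ (c : R) (y : SymmetricAlgebra R M), (0 < n → y ∈ symDeg R M (n - 1)) ∧ (n = 0 → y = 0) ∧
      x = c • SymmetricAlgebra.ι R M e₀ ^ n + SymmetricAlgebra.ι R M e₁ * y := by
  change x ∈ LinearMap.range (SymmetricAlgebra.ι R M) ^ n at hx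
  induction hx using Submodule.pow_induction_on_left' with
  | algebraMap r => exact ⟨r, 0, by simp, by simp, by simp [Algebra.smul_def]⟩
  | add x y i hx hy ihx ihy =>
    obtain ⟨c, y, h1, h2, rfl⟩ := ihx
    obtain ⟨c', y', h1', h2', rfl⟩ := ihy
    exact ⟨c + c', y + y', fun hi ↦ add_mem (h1 hi) (h1' hi), fun hi ↦ by rw [h2 hi, h2' hi, add_zero],
      by rw [add_smul]; ring⟩
  | mem_mul m hm i x hx ih =>
    obtain ⟨m, rfl⟩ := hm
    obtain ⟨p, q, rfl⟩ := Submodule.mem_span_pair.mp (he.ge (Submodule.mem_top (x := m)))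
    obtain ⟨c, y, h1, h2, hxy⟩ := ih
    -- For i = 0 the subtraction i - 1 truncates. This is why the statement records y = 0 in degree
    -- 0.
    have hmem : SymmetricAlgebra.ι R M e₀ * y ∈ symDeg R M i := by
      rcases Nat.eq_zero_or_pos i with rfl | hi
      · rw [h2 rfl, mul_zero]; exact zero_mem _
      · have := SetLike.mul_mem_graded (ι_mem_symDeg (R := R) e₀) (h1 hi)
        rwa [Nat.add_sub_cancel' hi] at this
    refine ⟨p * c, p • (SymmetricAlgebra.ι R M e₀ * y) + q • x, fun _ ↦ ?_, by simp, ?_⟩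
    · exact add_mem (Submodule.smul_mem _ _ hmem) (Submodule.smul_mem _ _ hx)
    · simp only [map_add, map_smul, Algebra.smul_def, map_mul, hxy, Nat.succ_eq_add_one]
      ring

lemma coeff_eq_zero_of_monomial_one_mul {a : R} (ha : ∀ r : R, a * r = 0 → r = 0)
    (f : R[X]) (hf : monomial 1 a * f = 0) : f = 0 := by
  ext n
  have h1 : monomial 1 a * f = X * (C a * f) := by
    rw [← mul_assoc, ← C_mul_X_eq_monomial]; ring
  rw [h1] at hf
  have h2 := congrArg (fun p ↦ coeff p (n + 1)) hf
  simp only [coeff_X_mul, coeff_C_mul, coeff_zero] at h2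
  simpa using ha _ h2

/-- The Rees algebra of an ideal generated by a regular sequence `a, b` is presented by the single
relation `a e₀ + b e₁`. -/
lemma dvd_of_symToRees_eq_zero {e₀ e₁ : M} (he : Submodule.span R {e₀, e₁} = ⊤) {a b : R}
    (h0 : θ e₀ = b) (h1 : θ e₁ = -a) (ha : ∀ r : R, a * r = 0 → r = 0)
    (hb : ∀ r : R, a ∣ b * r → a ∣ r) (n : ℕ) (x : SymmetricAlgebra R M) (hx : x ∈ symDeg R M n)
    (hx0 : symToRees I θ h x = 0) : SymmetricAlgebra.ι R M (a • e₀ + b • e₁) ∣ x := by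
  -- All powers of b are nonzerodivisors modulo a as well.
  have hb' : ∀ (n : ℕ) (r : R), a ∣ b ^ n * r → a ∣ r := by
    intro n
    induction n with
    | zero => simp
    | succ n ih => exact fun r hr ↦ ih r (hb _ (by rwa [← mul_assoc, ← pow_succ']))
  induction n generalizing x with
  | zero =>
    rw [symDeg, pow_zero, Submodule.mem_one] at hx
    obtain ⟨r, rfl⟩ := hx
    rw [symToRees_algebraMap] at hx0
    have : r = 0 := Polynomial.C_injective ((congrArg Subtype.val hx0).trans C_0.symm)
    rw [this, map_zero]
    exact dvd_zero _
  | succ n ih =>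
    obtain ⟨c, y, hy, -, rfl⟩ := symDeg_succ_eq_pow_add_mul he hx
    replace hy := hy n.succ_pos
    rw [Nat.add_sub_cancel] at hy
    set X₀ := SymmetricAlgebra.ι R M e₀
    set X₁ := SymmetricAlgebra.ι R M e₁
    have hX₀ : (symToRees I θ h X₀ : R[X]) = monomial 1 b := by rw [coe_symToRees_ι, h0]
    have hX₁ : (symToRees I θ h X₁ : R[X]) = monomial 1 (-a) := by rw [coe_symToRees_ι, h1]
    have h2 : C c * monomial 1 b ^ (n + 1) + monomial 1 (-a) * (symToRees I θ h y : R[X]) = 0 := by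
      have := congrArg Subtype.val hx0
      rw [map_add, Algebra.smul_def, map_mul, map_mul, map_pow, symToRees_algebraMap] at this
      rw [← hX₀, ← hX₁]
      exact this
    -- The coefficient of degree n + 1 in the relation says that bⁿ⁺¹ c is a multiple of a.
    obtain ⟨c', rfl⟩ : a ∣ c := by
      refine hb' (n + 1) c ⟨(symToRees I θ h y : R[X]).coeff n, ?_⟩
      have h3 := congrArg (fun p ↦ coeff p (n + 1)) h2
      rw [monomial_pow, one_mul, ← C_mul_X_eq_monomial (a := -a), mul_assoc] at h3
      simp only [coeff_add, coeff_C_mul, coeff_monomial_same, coeff_X_mul, coeff_zero] at h3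
      linear_combination h3
    have hm : SymmetricAlgebra.ι R M (a • e₀ + b • e₁) = a • X₀ + b • X₁ := by
      rw [map_add, map_smul, map_smul]
    -- After substituting c = a c', the whole relation is divisible by the nonzerodivisor a T, and
    -- cancelling it leaves a relation of degree n for the induction.
    have h4 : symToRees I θ h (y - (b * c') • X₀ ^ n) = 0 := by
      ext : 1
      refine coeff_eq_zero_of_monomial_one_mul ha _ ?_
      rw [Algebra.smul_def, map_sub, map_mul, map_pow, symToRees_algebraMap]
      change monomial 1 a * ((symToRees I θ h y : R[X]) -
        C (b * c') * (symToRees I θ h X₀ : R[X]) ^ n) = 0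
      rw [hX₀]
      rw [← C_mul_X_eq_monomial, ← C_mul_X_eq_monomial, map_neg, map_mul] at h2
      rw [← C_mul_X_eq_monomial, ← C_mul_X_eq_monomial, map_mul]
      linear_combination -h2
    have hX₀n : X₀ ^ n ∈ symDeg R M n := by
      simpa using SetLike.pow_mem_graded n (ι_mem_symDeg (R := R) e₀)
    obtain ⟨z, hz⟩ := ih _ (sub_mem hy (Submodule.smul_mem _ _ hX₀n)) h4
    -- Write m = a X₀ + b X₁ for the proposed divisor. Replacing a X₀ by m - b X₁ in a c' X₀ⁿ⁺¹ + X₁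
    -- y gives m c' X₀ⁿ + X₁ (y - b c' X₀ⁿ), and the bracket is m z by induction.
    refine ⟨c' • X₀ ^ n + X₁ * z, ?_⟩
    rw [hm] at hz ⊢
    simp only [Algebra.smul_def, map_mul] at hz ⊢
    linear_combination X₁ * hz

end SymToRees

/-! ### The linear form x ↦ x ∧ m on a free module of rank two. -/

section Wedge

open Module

variable {R R' M M' : Type u} [CommRing R] [CommRing R'] [AddCommGroup M] [Module R M]
  [AddCommGroup M'] [Module R' M']

/-- The linear form `x ↦ x ∧ m` on a free module of rank `2`. -/
def wedgeForm (e : Basis (Fin 2) R M) (m : M) : M →ₗ[R] R :=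
  e.repr m 1 • e.coord 0 - e.repr m 0 • e.coord 1

lemma wedgeForm_apply (e : Basis (Fin 2) R M) (m x : M) :
    wedgeForm e m x = e.repr m 1 * e.repr x 0 - e.repr m 0 * e.repr x 1 := rfl

lemma wedgeForm_eq_det (e : Basis (Fin 2) R M) (m x : M) :
    wedgeForm e m x = e.det ![x, m] := by
  rw [Basis.det_apply, Matrix.det_fin_two, wedgeForm_apply]
  simp only [Basis.toMatrix_apply, Matrix.cons_val_zero, Matrix.cons_val_one]
  ring

/-- The form is x ↦ det(x, m), and the determinants of two bases are proportional, with factor u =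
det of e relative to e'. -/
lemma exists_wedgeForm_eq_mul (e e' : Basis (Fin 2) R M) (m : M) :
    ∃ u : R, ∀ x, wedgeForm e' m x = u * wedgeForm e m x :=
  ⟨e'.det e, fun x ↦ by
    rw [wedgeForm_eq_det, wedgeForm_eq_det]
    exact congr($(e'.det.eq_smul_basis_det e) ![x, m])⟩

lemma eq_smul_add_smul (e : Basis (Fin 2) R M) (m : M) :
    m = e.repr m 0 • e 0 + e.repr m 1 • e 1 := by
  conv_lhs => rw [← e.sum_repr m, Fin.sum_univ_two]

lemma imageOfDual_eq_span_pair (e : Basis (Fin 2) R M) (m : M) :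
    imageOfDual m = Ideal.span {e.repr m 0, e.repr m 1} := by
  have h0 : e.repr m 0 ∈ Ideal.span {e.repr m 0, e.repr m 1} := Ideal.subset_span (Or.inl rfl)
  have h1 : e.repr m 1 ∈ Ideal.span {e.repr m 0, e.repr m 1} := Ideal.subset_span (Or.inr rfl)
  apply le_antisymm
  · rintro _ ⟨l, rfl⟩
    change l m ∈ _
    have hm := congrArg l (eq_smul_add_smul e m)
    rw [map_add, map_smul, map_smul, smul_eq_mul, smul_eq_mul] at hm
    rw [hm]
    exact add_mem (Ideal.mul_mem_right _ _ h0) (Ideal.mul_mem_right _ _ h1)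
  · rw [Ideal.span_le]
    rintro _ (rfl | rfl)
    · exact ⟨e.coord 0, rfl⟩
    · exact ⟨e.coord 1, rfl⟩

lemma wedgeForm_self_zero (e : Basis (Fin 2) R M) (m : M) : wedgeForm e m (e 0) = e.repr m 1 := by
  simp [wedgeForm_apply]

lemma wedgeForm_self_one (e : Basis (Fin 2) R M) (m : M) : wedgeForm e m (e 1) = -e.repr m 0 := by
  simp [wedgeForm_apply]

lemma range_wedgeForm (e : Basis (Fin 2) R M) (m : M) :
    LinearMap.range (wedgeForm e m) = imageOfDual m := by
  rw [imageOfDual_eq_span_pair e]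
  apply le_antisymm
  · rintro _ ⟨x, rfl⟩
    rw [wedgeForm_apply]
    exact sub_mem (Ideal.mul_mem_right _ _ (Ideal.subset_span (Or.inr rfl)))
      (Ideal.mul_mem_right _ _ (Ideal.subset_span (Or.inl rfl)))
  · rw [← Ideal.submodule_span_eq, Submodule.span_le]
    rintro _ (rfl | rfl)
    · exact ⟨-e 1, by rw [map_neg, wedgeForm_self_one, neg_neg]⟩
    · exact ⟨e 0, wedgeForm_self_zero e m⟩

lemma wedgeForm_self (e : Basis (Fin 2) R M) (m : M) : wedgeForm e m m = 0 := by
  rw [wedgeForm_apply, mul_comm, sub_self]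

lemma repr_semilinear {σ : R →+* R'} (g : M →ₛₗ[σ] M') {ι : Type*} [Fintype ι] (e : Basis ι R M)
    (e' : Basis ι R' M') (he : ∀ i, e' i = g (e i)) (x : M) (i : ι) :
    e'.repr (g x) i = σ (e.repr x i) := by
  classical
  have : g x = ∑ j, σ (e.repr x j) • e' j := by
    conv_lhs => rw [← e.sum_repr x]
    simp only [map_sum, map_smulₛₗ, he]
  rw [this, e'.repr_sum_self]

lemma wedgeForm_semilinear {σ : R →+* R'} (g : M →ₛₗ[σ] M') (e : Basis (Fin 2) R M)
    (e' : Basis (Fin 2) R' M') (he : ∀ i, e' i = g (e i)) (m x : M) :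
    σ (wedgeForm e m x) = wedgeForm e' (g m) (g x) := by
  simp only [wedgeForm_apply, repr_semilinear g e e' he, map_sub, map_mul]

end Wedge

/-! ### Localization of modules and of the image of the dual. -/

section Semilinear

open Module

variable {R R' M M' : Type u} [CommRing R] [CommRing R'] [AddCommGroup M] [Module R M]
  [AddCommGroup M'] [Module R' M']

lemma isLocalizedModule_of_semilinear [Algebra R R'] [Module R M'] [IsScalarTower R R' M']
    (g : M →ₗ[R] M') {f : R} [IsLocalization.Away f R']
    (surj : ∀ y : M', ∃ (n : ℕ) (x : M), algebraMap R R' f ^ n • y = g x)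
    (eq_zero : ∀ x : M, g x = 0 → ∃ n : ℕ, f ^ n • x = 0) :
    IsLocalizedModule (.powers f) g where
  map_units := by
    rintro ⟨_, n, rfl⟩
    have hu : IsUnit (algebraMap R R' (f ^ n)) := by
      rw [map_pow]; exact (IsLocalization.Away.algebraMap_isUnit f).pow n
    have h2 := (hu.map (algebraMap R' (Module.End R' M')))
    rw [Module.End.isUnit_iff] at h2 ⊢
    exact (funext fun x ↦ algebraMap_smul R' (f ^ n) x :
      ⇑(algebraMap R' (Module.End R' M') (algebraMap R R' (f ^ n))) =
        ⇑(algebraMap R (Module.End R M') (f ^ n))) ▸ h2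
  surj y := by
    obtain ⟨n, x, hx⟩ := surj y
    refine ⟨⟨x, ⟨_, n, rfl⟩⟩, ?_⟩
    rw [← hx, ← map_pow, algebraMap_smul]
    rfl
  exists_of_eq := by
    intro x y hxy
    obtain ⟨n, hn⟩ := eq_zero (x - y) (by rw [map_sub, hxy, sub_self])
    exact ⟨⟨_, n, rfl⟩, sub_eq_zero.mp ((smul_sub _ _ _).symm.trans hn)⟩

/-- For finitely presented M the dual commutes with localization: every linear form on M' becomes
the extension of one on M after multiplication by a power of f. -/
lemma map_imageOfDual {σ : R →+* R'} (g : M →ₛₗ[σ] M') {f : R}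
    (hσ : letI := σ.toAlgebra; IsLocalization.Away f R')
    (surj : ∀ y : M', ∃ (n : ℕ) (x : M), σ f ^ n • y = g x)
    (eq_zero : ∀ x : M, g x = 0 → ∃ n : ℕ, f ^ n • x = 0) [Module.FinitePresentation R M] (m : M) :
    (imageOfDual m).map σ = imageOfDual (g m) := by
  let := σ.toAlgebra
  have : IsLocalization.Away f R' := hσ
  let : Module R M' := Module.compHom M' σ
  have : IsScalarTower R R' M' := ⟨fun r r' x ↦ mul_smul (σ r) r' x⟩
  let g' : M →ₗ[R] M' := { toFun := g, map_add' := map_add g, map_smul' := map_smulₛₗ g }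
  have : IsLocalizedModule (.powers f) g' := isLocalizedModule_of_semilinear g' surj eq_zero
  let Λ := IsLocalizedModule.mapExtendScalars (.powers f) g' (Algebra.linearMap R R') R'
  have hΛ (l : M →ₗ[R] R) : Λ l (g m) = σ (l m) :=
    IsLocalizedModule.map_apply (.powers f) g' (Algebra.linearMap R R') l m
  apply le_antisymm
  · rw [Ideal.map_le_iff_le_comap]
    rintro _ ⟨l, rfl⟩
    exact ⟨Λ l, hΛ l⟩
  · rintro _ ⟨l, rfl⟩
    obtain ⟨⟨l', ⟨_, n, rfl⟩⟩, hl⟩ := IsLocalizedModule.surj (.powers f) Λ l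
    have h1 : σ f ^ n * l (g m) = σ (l' m) := by
      rw [← hΛ, ← hl, ← map_pow]
      rfl
    have hu : IsUnit (σ f ^ n) := (IsLocalization.Away.algebraMap_isUnit (S := R') f).pow n
    change l (g m) ∈ _
    rw [← Ideal.unit_mul_mem_iff_mem _ hu, h1]
    exact Ideal.mem_map_of_mem σ ⟨l', rfl⟩

end Semilinear

/-! ### Frames, finite presentation of sections, and the ideal of the zero locus. -/

section Sheaf

open Module

variable {S : Scheme.{u}} {E : S.Modules}

/-- The basis of the sections over `V ≤ U` given by a frame over `U`. -/
def IsFrame.basis {U : S.Opens} {r : ℕ} {e : Fin r → Γ(E, U)} (he : IsFrame E e) {V : S.Opens}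
    (h : V ≤ U) : Basis (Fin r) Γ(S, V) Γ(E, V) :=
  Basis.mk (he V h).1 (he V h).2.ge

lemma IsFrame.basis_apply {U : S.Opens} {r : ℕ} {e : Fin r → Γ(E, U)} (he : IsFrame E e)
    {V : S.Opens} (h : V ≤ U) (i : Fin r) : he.basis h i = moduleRes E h (e i) :=
  Basis.mk_apply _ _ _

lemma IsFrame.basis_res {U : S.Opens} {r : ℕ} {e : Fin r → Γ(E, U)} (he : IsFrame E e)
    {V W : S.Opens} (h : V ≤ U) (h' : W ≤ V) (i : Fin r) :
    he.basis (h'.trans h) i = moduleRes E h' (he.basis h i) := by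
  rw [basis_apply, basis_apply, moduleRes_res]

variable [SheafOfModules.IsQuasicoherent (R := S.ringCatSheaf) E]

/-- Finite presentation can be checked on basic opens covering U. Those contained in the domain of a
frame cover U, and over them the sections are free of finite rank. -/
lemma finitePresentation_sections {r : ℕ} (hE : HasRank E r) {U : S.Opens} (hU : IsAffineOpen U) :
    Module.FinitePresentation Γ(S, U) Γ(E, U) := by
  let s : Set Γ(S, U) := { f | ∃ (V : S.Opens) (_ : S.basicOpen f ≤ V) (e : Fin r → Γ(E, V)),
    IsFrame E e }
  have hs : Ideal.span s = ⊤ := by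
    rw [← hU.self_le_iSup_basicOpen_iff]
    intro x hx
    obtain ⟨V, hxV, e, he⟩ := hE x
    obtain ⟨f, hf, hxf⟩ := hU.exists_basicOpen_le ⟨x, hxV⟩ hx
    exact TopologicalSpace.Opens.mem_iSup.mpr ⟨⟨f, V, hf, e, he⟩, hxf⟩
  let (f : s) : Algebra Γ(S, U) Γ(S, S.basicOpen f.1) :=
    (S.presheaf.map (homOfLE (S.basicOpen_le f.1)).op).hom.toAlgebra
  have (f : s) : IsLocalization.Away f.1 Γ(S, S.basicOpen f.1) := hU.isLocalization_basicOpen f.1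
  let (f : s) : Module Γ(S, U) Γ(E, S.basicOpen f.1) := Module.compHom _
    (S.presheaf.map (homOfLE (S.basicOpen_le f.1)).op).hom
  have (f : s) : IsScalarTower Γ(S, U) Γ(S, S.basicOpen f.1) Γ(E, S.basicOpen f.1) :=
    ⟨fun r r' x ↦ mul_smul ((S.presheaf.map (homOfLE (S.basicOpen_le f.1)).op).hom r) r' x⟩
  let g (f : s) : Γ(E, U) →ₗ[Γ(S, U)] Γ(E, S.basicOpen f.1) :=
    { toFun := moduleRes E (S.basicOpen_le f.1)
      map_add' := map_add _
      map_smul' := (moduleRes E (S.basicOpen_le f.1)).map_smul' }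
  have (f : s) : IsLocalizedModule (.powers f.1) (g f) :=
    isLocalizedModule_of_semilinear _ (moduleRes_surj E hU f.1) (moduleRes_eq_zero E hU f.1)
  refine Module.FinitePresentation.of_localizationSpan' s hs
    (Rₚ := fun f : s ↦ Γ(S, S.basicOpen f.1)) g fun f ↦ ?_
  obtain ⟨V, hV, e, he⟩ := f.2
  have := Module.Free.of_basis (he.basis hV)
  have := Module.Finite.of_basis (he.basis hV)
  exact Module.finitePresentation_of_projective _ _

/-- The local images of the dual are compatible with restriction to basic opens by
`map_imageOfDual`. They thus already form an ideal sheaf, which `ofIdeals` leaves unchanged. -/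
lemma zeroIdeal_ideal {r : ℕ} (hE : HasRank E r) (s : Γ(E, ⊤)) (U : S.affineOpens) :
    (zeroIdeal s).ideal U = imageOfDual (R := Γ(S, U.1)) (moduleRes E (le_top : U.1 ≤ ⊤) s) := by
  let J : S.IdealSheafData :=
    ⟨fun U ↦ imageOfDual (R := Γ(S, U.1)) (moduleRes E (le_top : U.1 ≤ ⊤) s), fun U f ↦ by
      have := finitePresentation_sections hE U.2
      refine (map_imageOfDual (moduleRes E (S.basicOpen_le f)) (f := f)
        (U.2.isLocalization_basicOpen f) (moduleRes_surj E U.2 f) (moduleRes_eq_zero E U.2 f)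
        (moduleRes E (le_top : U.1 ≤ ⊤) s)).trans ?_
      rw [moduleRes_res]
      rfl, _, rfl⟩
  exact congr($(Scheme.IdealSheafData.ofIdeals_ideal J).ideal U)

end Sheaf

/-! ### Regular pairs and their spreading out from a prime. -/

section RegularPair

open scoped Pointwise

variable {R R' : Type*} [CommRing R] [CommRing R']

/-- `a` is a nonzerodivisor and `b` is a nonzerodivisor modulo `a`. -/
structure IsRegularPair (a b : R) : Prop where
  left : ∀ r : R, a * r = 0 → r = 0
  right : ∀ r : R, a ∣ b * r → a ∣ r

lemma IsRegularPair.of_isWeaklyRegular {a b : R}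
    (h : RingTheory.Sequence.IsWeaklyRegular R [a, b]) : IsRegularPair a b := by
  rw [RingTheory.Sequence.isWeaklyRegular_cons_iff,
    RingTheory.Sequence.isWeaklyRegular_singleton_iff] at h
  have key (x : R) : x ∈ a • (⊤ : Submodule R R) ↔ a ∣ x := by
    rw [Submodule.mem_smul_pointwise_iff_exists]
    exact ⟨fun ⟨y, _, hy⟩ ↦ ⟨y, hy.symm⟩, fun ⟨y, hy⟩ ↦ ⟨y, trivial, hy.symm⟩⟩
  refine ⟨fun r hr ↦ h.1 (hr.trans (smul_zero a).symm), fun r hr ↦ ?_⟩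
  exact (key r).mp ((isSMulRegular_quotient_iff_mem_of_smul_mem _ _).mp h.2 r ((key _).mpr hr))

/-- A regular pair may generate the unit ideal, so points outside the zero locus are covered too. -/
lemma IsRegularPair.of_isUnit {a : R} (ha : IsUnit a) (b : R) : IsRegularPair a b :=
  ⟨fun _ ↦ ha.mul_right_eq_zero.mp, fun _ _ ↦ ha.dvd⟩

/-- The product of the denominators of finitely many generators serves for the whole ideal. -/
lemma exists_notMem_forall_mul_mem (p : Ideal R) [p.IsPrime] {I J : Ideal R} (hI : I.FG)
    (h : ∀ r ∈ I, ∃ g ∉ p, g * r ∈ J) : ∃ f ∉ p, ∀ r ∈ I, f * r ∈ J := by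
  classical
  obtain ⟨t, rfl⟩ := hI
  choose! g hg hg' using h
  refine ⟨∏ i ∈ t, g i, p.primeCompl.prod_mem fun i hi ↦ hg i (Ideal.subset_span hi), ?_⟩
  suffices Ideal.span t ≤ Submodule.comap (LinearMap.mulLeft R (∏ i ∈ t, g i)) J from this
  rw [Ideal.span_le]
  intro i hi
  change (∏ i ∈ t, g i) * i ∈ J
  rw [← Finset.prod_erase_mul t g hi, mul_assoc]
  exact Ideal.mul_mem_left _ _ (hg' i (Ideal.subset_span hi))

/-- Regularity says that the annihilator I₁ of a is zero and that I₂ = (a : b) lies in (a). Both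
ideals are finitely generated, so if this holds at p it holds after inverting a single f ∉ p. -/
lemma IsRegularPair.exists_away [IsNoetherianRing R] (p : Ideal R) [p.IsPrime] (Rₚ : Type*)
    [CommRing Rₚ] [Algebra R Rₚ] [IsLocalization.AtPrime Rₚ p] {a b : R}
    (h : IsRegularPair (algebraMap R Rₚ a) (algebraMap R Rₚ b)) :
    ∃ f ∉ p, ∀ (R' : Type*) [CommRing R'] [Algebra R R'] [IsLocalization.Away f R'],
      IsRegularPair (algebraMap R R' a) (algebraMap R R' b) := by
  let I₁ : Ideal R := LinearMap.ker (LinearMap.mulLeft R a)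
  let I₂ : Ideal R := Submodule.comap (LinearMap.mulLeft R b) (Ideal.span {a})
  have hI₁ (r : R) : r ∈ I₁ ↔ a * r = 0 := Iff.rfl
  have hI₂ (r : R) : r ∈ I₂ ↔ a ∣ b * r := Ideal.mem_span_singleton
  obtain ⟨f₁, hf₁, h₁⟩ := exists_notMem_forall_mul_mem p (I := I₁) (J := ⊥)
    (IsNoetherian.noetherian _) fun r hr ↦ by
    rw [hI₁] at hr
    have := h.left (algebraMap R Rₚ r) (by rw [← map_mul, hr, map_zero])
    obtain ⟨⟨g, hg⟩, e⟩ := (IsLocalization.map_eq_zero_iff p.primeCompl Rₚ r).mp this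
    exact ⟨g, hg, e⟩
  obtain ⟨f₂, hf₂, h₂⟩ := exists_notMem_forall_mul_mem p (I := I₂) (J := Ideal.span {a})
    (IsNoetherian.noetherian _) fun r hr ↦ by
    rw [hI₂] at hr
    have h3 := h.right (algebraMap R Rₚ r) (by rw [← map_mul]; exact map_dvd _ hr)
    have h4 : algebraMap R Rₚ r ∈ (Ideal.span {a}).map (algebraMap R Rₚ) := by
      rwa [Ideal.map_span, Set.image_singleton, Ideal.mem_span_singleton]
    obtain ⟨⟨⟨c, hc⟩, ⟨g, hg⟩⟩, e⟩ :=
      (IsLocalization.mem_map_algebraMap_iff p.primeCompl Rₚ).mp h4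
    rw [← map_mul] at e
    obtain ⟨⟨g', hg'⟩, e'⟩ := (IsLocalization.eq_iff_exists p.primeCompl Rₚ).mp e
    refine ⟨g' * g, p.primeCompl.mul_mem hg' hg, ?_⟩
    rw [mul_assoc, mul_comm g, e']
    exact Ideal.mul_mem_left _ _ hc
  refine ⟨f₁ * f₂, p.primeCompl.mul_mem hf₁ hf₂, fun R' _ _ _ ↦ ?_⟩
  set f := f₁ * f₂
  have hu (n : ℕ) : IsUnit (algebraMap R R' f ^ n) := (IsLocalization.Away.algebraMap_isUnit f).pow n
  constructor
  · intro ρ hρ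
    obtain ⟨n, r, hr⟩ := IsLocalization.Away.surj f ρ
    have h3 : algebraMap R R' (a * r) = 0 := by rw [map_mul, ← hr, ← mul_assoc, hρ, zero_mul]
    obtain ⟨⟨_, m, rfl⟩, hm⟩ := (IsLocalization.map_eq_zero_iff (.powers f) R' _).mp h3
    have h4 : f₁ * (f ^ m * r) = 0 := h₁ _ ((hI₁ _).mpr (by linear_combination hm))
    have h5 : algebraMap R R' r = 0 := by
      rw [← (hu (m + 1)).mul_right_eq_zero, ← map_pow, ← map_mul,
        show f ^ (m + 1) * r = 0 by simp only [f] at h4 ⊢; linear_combination f₂ * h4, map_zero]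
    rwa [h5, (hu n).mul_left_eq_zero] at hr
  · rintro ρ ⟨τ, hτ⟩
    obtain ⟨n, r, hr⟩ := IsLocalization.Away.surj f ρ
    obtain ⟨k, t, ht⟩ := IsLocalization.Away.surj f τ
    have h3 : algebraMap R R' (b * (f ^ k * r)) = algebraMap R R' (a * (f ^ n * t)) := by
      simp only [map_mul, map_pow, ← hr, ← ht]
      linear_combination (algebraMap R R' f ^ n * algebraMap R R' f ^ k) * hτ
    obtain ⟨⟨_, m, rfl⟩, hm⟩ := (IsLocalization.eq_iff_exists (.powers f) R').mp h3
    obtain ⟨c, hc⟩ := Ideal.mem_span_singleton.mp (h₂ (f ^ (m + k) * r) ((hI₂ _).mpr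
      ⟨f ^ (m + n) * t, by simp only at hm; linear_combination hm⟩))
    have h4 : algebraMap R R' a ∣ algebraMap R R' f ^ (m + k + 1) * algebraMap R R' r := by
      rw [← map_pow, ← map_mul]
      exact map_dvd _ ⟨f₁ * c, by simp only [f] at hc ⊢; linear_combination f₁ * hc⟩
    rw [(hu _).dvd_mul_left, ← hr, (hu _).dvd_mul_right] at h4
    exact h4

end RegularPair

/-! ### Existence of regular charts around every point. -/

section Charts

open Module

variable {S : Scheme.{u}} {E : S.Modules}

/-- An affine open of `S` with a frame of `E` over it, such that the components of `s` with respect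
to this frame form a regular pair. -/
structure RegularChart (s : Γ(E, ⊤)) where
  /-- The affine open. -/
  U : S.AffineZariskiSite
  /-- The frame. -/
  e : Fin 2 → Γ(E, U.toOpens)
  isFrame : IsFrame E e
  isRegularPair : IsRegularPair ((isFrame.basis le_rfl).repr (moduleRes E le_top s) 0)
    ((isFrame.basis le_rfl).repr (moduleRes E le_top s) 1)

lemma IsFrame.res {U V : S.Opens} {r : ℕ} {e : Fin r → Γ(E, U)} (he : IsFrame E e) (h : V ≤ U) :
    IsFrame E fun i ↦ moduleRes E h (e i) := fun W hW ↦ by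
  simp only [moduleRes_res]
  exact he W (hW.trans h)

lemma IsFrame.comp_equiv {U : S.Opens} {r : ℕ} {e : Fin r → Γ(E, U)} (he : IsFrame E e)
    (π : Equiv.Perm (Fin r)) : IsFrame E (e ∘ π) := fun V hV ↦ by
  refine ⟨(he V hV).1.comp π π.injective, ?_⟩
  rw [← (he V hV).2]
  congr 1
  exact π.surjective.range_comp fun i ↦ moduleRes E hV (e i)

lemma exists_regularChart_of_isRegularPair [IsLocallyNoetherian S] (s : Γ(E, ⊤)) {U : S.Opens}
    {x : S} (hx : x ∈ U) {e : Fin 2 → Γ(E, U)} (he : IsFrame E e) (c : Fin 2 → Γ(S, U))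
    (hc : moduleRes E le_top s = ∑ i, c i • e i)
    (h : IsRegularPair (S.presheaf.germ U x hx (c 0)) (S.presheaf.germ U x hx (c 1))) :
    ∃ C : RegularChart s, x ∈ C.U.toOpens := by
  obtain ⟨_, ⟨W, hW, rfl⟩, hxW, hWU⟩ := S.isBasis_affineOpens.exists_subset_of_mem_open hx U.2
  replace hWU : W ≤ U := hWU
  have : IsNoetherianRing Γ(S, W) := IsLocallyNoetherian.component_noetherian ⟨W, hW⟩
  let p := hW.primeIdealOf ⟨x, hxW⟩
  let := S.presheaf.algebra_section_stalk (⟨x, hxW⟩ : W)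
  have : IsLocalization.AtPrime (S.presheaf.stalk x) p.asIdeal :=
    hW.isLocalization_stalk ⟨x, hxW⟩
  let c' (i : Fin 2) : Γ(S, W) := S.presheaf.map (homOfLE hWU).op (c i)
  have hc' (i : Fin 2) : algebraMap Γ(S, W) (S.presheaf.stalk x) (c' i) =
      S.presheaf.germ U x hx (c i) := S.presheaf.germ_res_apply (homOfLE hWU) x hxW (c i)
  rw [← hc', ← hc'] at h
  obtain ⟨f, hf, H⟩ := h.exists_away p.asIdeal
  have : IsLocalization.Away f Γ(S, S.basicOpen f) := hW.isLocalization_basicOpen f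
  have hD : S.basicOpen f ≤ U := (S.basicOpen_le f).trans hWU
  -- The components with respect to the restricted frame are the restrictions of c, so the
  -- conclusion of `exists_away` applies to them.
  have hrepr (i : Fin 2) : ((he.res hD).basis le_rfl).repr (moduleRes E le_top s) i =
      (S.presheaf.map (homOfLE (S.basicOpen_le f)).op) (c' i) := by
    have h1 : moduleRes E le_top s = ∑ i, S.presheaf.map (homOfLE (S.basicOpen_le f)).op (c' i) •
        (he.res hD).basis le_rfl i := by
      rw [← moduleRes_res E hD le_top, hc, map_sum]
      refine Finset.sum_congr rfl fun i _ ↦ ?_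
      rw [map_smulₛₗ, IsFrame.basis_apply, moduleRes_self]
      congr 1
      exact congr($(S.presheaf.map_comp (homOfLE hWU).op (homOfLE (S.basicOpen_le f)).op) (c i))
    rw [h1, Basis.repr_sum_self]
  refine ⟨⟨⟨S.basicOpen f, hW.basicOpen f⟩, _, he.res hD, ?_⟩, ?_⟩
  · have := H Γ(S, S.basicOpen f)
    rw [hrepr, hrepr]
    exact this
  · change x ∈ S.basicOpen f
    rw [S.mem_basicOpen f x hxW]
    exact (IsLocalization.AtPrime.isUnit_to_map_iff (S.presheaf.stalk x) p.asIdeal f).mpr hf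

lemma repr_basis_eq {U : S.Opens} {e : Fin 2 → Γ(E, U)} (he : IsFrame E e) (m : Γ(E, U)) :
    m = ∑ i, (he.basis le_rfl).repr m i • e i := by
  conv_lhs => rw [← (he.basis le_rfl).sum_repr m]
  simp only [IsFrame.basis_apply, moduleRes_self]

/-- At a point of the zero locus the hypothesis provides a frame with regular germs. Elsewhere some
component of s is a unit in the stalk, since the components generate the ideal; the frame is swapped
if needed so that the unit comes first. -/
lemma exists_regularChart [IsLocallyNoetherian S]
    [SheafOfModules.IsQuasicoherent (R := S.ringCatSheaf) E] (hE : HasRank E 2) (s : Γ(E, ⊤))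
    (hs : IsRegularSection 2 s) (x : S) : ∃ C : RegularChart s, x ∈ C.U.toOpens := by
  by_cases hx : x ∈ (zeroIdeal s).support
  · obtain ⟨U, hxU, e, c, he, hc, h⟩ := hs x hx
    refine exists_regularChart_of_isRegularPair s hxU he c hc (.of_isWeaklyRegular ?_)
    simpa using h.toIsWeaklyRegular
  obtain ⟨U', hxU', e', he'⟩ := hE x
  obtain ⟨_, ⟨U, hU, rfl⟩, hxU, hUU'⟩ := S.isBasis_affineOpens.exists_subset_of_mem_open hxU' U'.2
  obtain ⟨e, he⟩ : ∃ e : Fin 2 → Γ(E, U), IsFrame E e := ⟨_, he'.res hUU'⟩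
  set c := fun i ↦ (he.basis le_rfl).repr (moduleRes E le_top s) i with hc
  have h1 : IsUnit (S.presheaf.germ U x hxU (c 0)) ∨ IsUnit (S.presheaf.germ U x hxU (c 1)) := by
    rw [← S.mem_basicOpen, ← S.mem_basicOpen]
    contrapose! hx
    rw [Scheme.IdealSheafData.mem_support_iff_of_mem (U := ⟨U, hU⟩) hxU, zeroIdeal_ideal hE,
      imageOfDual_eq_span_pair (he.basis le_rfl), Scheme.zeroLocus_span, Scheme.mem_zeroLocus_iff]
    rintro _ (rfl | rfl)
    exacts [hx.1, hx.2]
  rcases h1 with h1 | h1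
  · exact exists_regularChart_of_isRegularPair s hxU he c (repr_basis_eq he _) (.of_isUnit h1 _)
  · refine exists_regularChart_of_isRegularPair s hxU (he.comp_equiv (Equiv.swap 0 1))
      (c ∘ Equiv.swap 0 1) ?_ (.of_isUnit (by simpa using h1) _)
    refine (repr_basis_eq he _).trans ?_
    exact (Equiv.sum_comp (Equiv.swap 0 1) fun i ↦ c i • e i).symm

end Charts

/-! ### Ideal sheaves under open covers and base change. -/

section IdealSheaf

lemma le_of_comap_le_comap {X : Scheme.{u}} (𝒰 : X.OpenCover) {I J : X.IdealSheafData}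
    (h : ∀ i, I.comap (𝒰.f i) ≤ J.comap (𝒰.f i)) : I ≤ J := by
  refine Scheme.IdealSheafData.le_of_iSup_eq_top
    (ι := Σ i, (𝒰.X i).affineOpens)
    (fun p ↦ ⟨𝒰.f p.1 ''ᵁ p.2, p.2.2.image_of_isOpenImmersion (𝒰.f p.1)⟩) ?_ fun ⟨i, V⟩ ↦ ?_
  · refine eq_top_iff.mpr fun x _ ↦ ?_
    obtain ⟨i, y, rfl⟩ := 𝒰.exists_eq x
    obtain ⟨_, ⟨V, hV, rfl⟩, hyV, -⟩ :=
      (𝒰.X i).isBasis_affineOpens.exists_subset_of_mem_open (Set.mem_univ y) isOpen_univ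
    exact TopologicalSpace.Opens.mem_iSup.mpr ⟨⟨i, V, hV⟩, y, hyV, rfl⟩
  · have h1 := h i V
    rw [Scheme.IdealSheafData.ideal_comap_of_isOpenImmersion,
      Scheme.IdealSheafData.ideal_comap_of_isOpenImmersion] at h1
    have hs : Function.Surjective ((𝒰.f i).appIso V).inv.hom :=
      ((𝒰.f i).appIso V).symm.commRingCatIsoToRingEquiv.surjective
    exact (Ideal.comap_le_comap_iff_of_surjective _ hs _ _).mp h1

lemma ker_comap_of_isPullback {X Y Z W : Scheme.{u}} {f : W ⟶ X} {g : W ⟶ Y} {h : X ⟶ Z}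
    {i : Y ⟶ Z} [IsClosedImmersion i] (H : IsPullback f g h i) : i.ker.comap h = f.ker := by
  rw [← Scheme.IdealSheafData.ker_fst_of_isClosedImmersion, ← H.isoPullback_hom_fst,
    Scheme.Hom.ker_comp_of_isIso]

end IdealSheaf

/-! ### Gluing closed immersions between relative homogeneous spectra. -/

namespace GradedAlgebraData

variable {S : Scheme.{u}} (𝒜 : GradedAlgebraData S)

lemma map_projι {V U : S.AffineZariskiSite} (h : V ≤ U) :
    Proj.map (𝒜.res h) (𝒜.irrelevant_le h) ≫ 𝒜.projι U = 𝒜.projι V :=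
  let f : V ⟶ U := homOfLE h
  𝒜.relativeGluingData.cover.trans_map f

/-- The morphism `Proj A(U) ⟶ U`. -/
def projToOpen (U : S.AffineZariskiSite) : Proj (𝒜.deg U) ⟶ U.toOpens.toScheme :=
  𝒜.relativeGluingData.natTrans.app U

lemma projToOpen_eq (U : S.AffineZariskiSite) :
    𝒜.projToOpen U = projToSpec (𝒜.deg U) ≫ U.2.isoSpec.inv := rfl

lemma isPullback_projι (U : S.AffineZariskiSite) :
    IsPullback (𝒜.projToOpen U) (𝒜.projι U) U.toOpens.ι 𝒜.relProjToBase :=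
  𝒜.relativeGluingData.isPullback_natTrans_ι_toBase U

lemma exists_projι_eq (U : S.AffineZariskiSite) (x : 𝒜.relProj)
    (hx : 𝒜.relProjToBase x ∈ U.toOpens) : ∃ y, 𝒜.projι U y = x := by
  have h := 𝒜.relativeGluingData.preimage_toBase_eq_range_ι U
  have : x ∈ 𝒜.relativeGluingData.toBase ⁻¹' (Set.range U.toOpens.ι) := ⟨⟨_, hx⟩, rfl⟩
  exact h.le this

/-- The cover of `Proj_S A` by the schemes `Proj A(U)` for a family of affine opens `U` which
covers `S`. -/
def projCover {ι : Type u} (U : ι → S.AffineZariskiSite) (hU : ∀ x : S, ∃ i, x ∈ (U i).toOpens) :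
    𝒜.relProj.OpenCover :=
  Scheme.Cover.mkOfCovers ι (fun i ↦ Proj (𝒜.deg (U i))) (fun i ↦ 𝒜.projι (U i)) fun x ↦ by
    obtain ⟨i, hi⟩ := hU (𝒜.relProjToBase x)
    exact ⟨i, 𝒜.exists_projι_eq _ x hi⟩

/-- The intersection of the charts over V and W is covered by the charts over those T that are basic
open in both. -/
lemma pullback_hom_ext {X : Scheme.{u}} {V W : S.AffineZariskiSite}
    {f g : pullback (𝒜.projι V) (𝒜.projι W) ⟶ X}
    (h : ∀ (T : S.AffineZariskiSite) (h₁ : T ≤ V) (h₂ : T ≤ W),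
      pullback.lift (Proj.map (𝒜.res h₁) (𝒜.irrelevant_le h₁))
        (Proj.map (𝒜.res h₂) (𝒜.irrelevant_le h₂)) (by rw [map_projι, map_projι]) ≫ f =
      pullback.lift (Proj.map (𝒜.res h₁) (𝒜.irrelevant_le h₁))
        (Proj.map (𝒜.res h₂) (𝒜.irrelevant_le h₂)) (by rw [map_projι, map_projι]) ≫ g) :
    f = g :=
  (𝒜.relativeGluingData.cover.intersectionOfLocallyDirected V W).hom_ext _ _
    fun ⟨T, h₁, h₂⟩ ↦ h T (leOfHom h₁) (leOfHom h₂)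

/-- Compatible closed immersions `Proj B(U) ⟶ Proj A(U)` over `U`, where `U` runs through a basis of
affine opens of `S`. -/
structure LocalClosedImmersion (𝒜 ℬ : GradedAlgebraData S) where
  /-- The affine opens which belong to the basis. -/
  basis : S.AffineZariskiSite → Prop
  mono {V U : S.AffineZariskiSite} : V ≤ U → basis U → basis V
  exists_mem (x : S) : ∃ U, basis U ∧ x ∈ U.toOpens
  /-- The closed immersions. -/
  hom (U : S.AffineZariskiSite) : basis U → (Proj (ℬ.deg U) ⟶ Proj (𝒜.deg U))
  isClosedImmersion (U : S.AffineZariskiSite) (hU : basis U) : IsClosedImmersion (hom U hU)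
  hom_toSpec (U : S.AffineZariskiSite) (hU : basis U) :
    hom U hU ≫ projToSpec (𝒜.deg U) = projToSpec (ℬ.deg U)
  naturality {V U : S.AffineZariskiSite} (h : V ≤ U) (hU : basis U) :
    Proj.map (ℬ.res h) (ℬ.irrelevant_le h) ≫ hom U hU =
      hom V (mono h hU) ≫ Proj.map (𝒜.res h) (𝒜.irrelevant_le h)

namespace LocalClosedImmersion

variable {𝒜 ℬ : GradedAlgebraData S} (k : LocalClosedImmersion 𝒜 ℬ)

/-- The cover of `Proj_S A` by the schemes `Proj A(U)` for `U` in the basis. -/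
def cover (𝒞 : GradedAlgebraData S) : 𝒞.relProj.OpenCover :=
  𝒞.projCover (ι := { U // k.basis U }) Subtype.val fun x ↦
    have ⟨U, hU, hx⟩ := k.exists_mem x
    ⟨⟨U, hU⟩, hx⟩

/-- The morphism `Proj_S B ⟶ Proj_S A` obtained by gluing. -/
def glue : ℬ.relProj ⟶ 𝒜.relProj :=
  (k.cover ℬ).glueMorphisms (fun U ↦ k.hom U.1 U.2 ≫ 𝒜.projι U.1) fun V W ↦
    ℬ.pullback_hom_ext fun T h₁ h₂ ↦ by
      change pullback.lift _ _ _ ≫ pullback.fst _ _ ≫ k.hom V.1 V.2 ≫ 𝒜.projι V.1 =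
        pullback.lift _ _ _ ≫ pullback.snd _ _ ≫ k.hom W.1 W.2 ≫ 𝒜.projι W.1
      rw [pullback.lift_fst_assoc, pullback.lift_snd_assoc, ← Category.assoc, ← Category.assoc,
        k.naturality, k.naturality, Category.assoc, Category.assoc, map_projι, map_projι]

lemma projι_glue (U : S.AffineZariskiSite) (hU : k.basis U) :
    ℬ.projι U ≫ k.glue = k.hom U hU ≫ 𝒜.projι U :=
  (k.cover ℬ).ι_glueMorphisms _ _ ⟨U, hU⟩

lemma hom_toOpen (U : S.AffineZariskiSite) (hU : k.basis U) :
    k.hom U hU ≫ 𝒜.projToOpen U = ℬ.projToOpen U := by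
  rw [projToOpen_eq, projToOpen_eq, ← k.hom_toSpec U hU, Category.assoc]

lemma glue_toBase : k.glue ≫ 𝒜.relProjToBase = ℬ.relProjToBase := by
  refine (k.cover ℬ).hom_ext _ _ fun ⟨U, hU⟩ ↦ ?_
  change ℬ.projι U ≫ k.glue ≫ _ = ℬ.projι U ≫ _
  rw [← Category.assoc, k.projι_glue U hU, Category.assoc, ← (𝒜.isPullback_projι U).w,
    ← (ℬ.isPullback_projι U).w,
    ← Category.assoc, hom_toOpen]

/-- Both charts are the preimages of U under the structure morphisms, so pullback pasting applies.
Through this square the glued map inherits closedness and its kernel from the local maps. -/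
lemma isPullback_glue (U : S.AffineZariskiSite) (hU : k.basis U) :
    IsPullback (k.hom U hU) (ℬ.projι U) (𝒜.projι U) k.glue := by
  refine IsPullback.of_right ?_ (k.projι_glue U hU).symm (𝒜.isPullback_projι U)
  rw [hom_toOpen, glue_toBase]
  exact ℬ.isPullback_projι U

instance : IsClosedImmersion k.glue := by
  refine (IsZariskiLocalAtTarget.iff_of_openCover (P := @IsClosedImmersion) (k.cover 𝒜)).mpr
    fun ⟨U, hU⟩ ↦ ?_
  have := k.isClosedImmersion U hU
  have h := (k.isPullback_glue U hU).flip
  change IsClosedImmersion (pullback.snd k.glue (𝒜.projι U))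
  rwa [← h.isoPullback_inv_snd, MorphismProperty.cancel_left_of_respectsIso @IsClosedImmersion]

lemma ker_glue_comap (U : S.AffineZariskiSite) (hU : k.basis U) :
    k.glue.ker.comap (𝒜.projι U) = (k.hom U hU).ker :=
  ker_comap_of_isPullback (k.isPullback_glue U hU)

lemma ker_glue_le {J : 𝒜.relProj.IdealSheafData}
    (h : ∀ x : S, ∃ (U : S.AffineZariskiSite) (hU : k.basis U), x ∈ U.toOpens ∧
      (k.hom U hU).ker ≤ J.comap (𝒜.projι U)) : k.glue.ker ≤ J :=
  le_of_comap_le_comap (𝒜.projCover (fun U : { U : S.AffineZariskiSite //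
      ∃ hU : k.basis U, (k.hom U hU).ker ≤ J.comap (𝒜.projι U) } ↦ U.1) fun x ↦ by
    obtain ⟨U, hU, hx, h⟩ := h x
    exact ⟨⟨U, hU, h⟩, hx⟩) fun ⟨U, hU, h⟩ ↦ (k.ker_glue_comap U hU).trans_le h

/-- Here U need not belong to the basis, so Proj A(U) is covered by the Proj A(V) with V ≤ U in the
basis, and the inclusion is tested on each. -/
lemma le_ker_glue_comap (U : S.AffineZariskiSite) {I : (Proj (𝒜.deg U)).IdealSheafData}
    (h : ∀ (V : S.AffineZariskiSite) (hV : k.basis V) (hVU : V ≤ U),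
      I ≤ (k.hom V hV ≫ Proj.map (𝒜.res hVU) (𝒜.irrelevant_le hVU)).ker) :
    I ≤ k.glue.ker.comap (𝒜.projι U) := by
  let 𝒰 : (Proj (𝒜.deg U)).OpenCover :=
    Scheme.Cover.mkOfCovers { V : S.AffineZariskiSite // k.basis V ∧ V ≤ U }
      (fun V ↦ Proj (𝒜.deg V.1)) (fun V ↦ Proj.map (𝒜.res V.2.2) (𝒜.irrelevant_le V.2.2))
      (fun y ↦ by
        have hx : 𝒜.relProjToBase (𝒜.projι U y) ∈ U.toOpens := by
          rw [← Scheme.Hom.comp_apply, ← (𝒜.isPullback_projι U).w, Scheme.Hom.comp_apply]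
          exact (𝒜.projToOpen U y).2
        obtain ⟨W, hW, hxW⟩ := k.exists_mem (𝒜.relProjToBase (𝒜.projι U y))
        -- The order on the site means "basic open in", so a neighbourhood that is basic open in
        -- both U and W is required.
        obtain ⟨f, g, e, hxf⟩ := exists_basicOpen_le_affine_inter U.2 W.2 _ ⟨hx, hxW⟩
        have hVW : U.basicOpen f ≤ W := by
          rw [show U.basicOpen f = W.basicOpen g from Subtype.ext e]
          exact W.basicOpen_le g
        refine ⟨⟨U.basicOpen f, k.mono hVW hW, U.basicOpen_le f⟩, ?_⟩
        obtain ⟨z, hz⟩ := 𝒜.exists_projι_eq (U.basicOpen f) _ hxf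
        refine ⟨z, (𝒜.projι U).injective ?_⟩
        rw [← Scheme.Hom.comp_apply, map_projι, hz])
      fun V ↦ (𝒜.isLocalization_of_le V.2.2).choose_spec.2.isOpenImmersion_map
  refine le_of_comap_le_comap 𝒰 fun ⟨V, hV, hVU⟩ ↦ ?_
  change I.comap (Proj.map (𝒜.res hVU) (𝒜.irrelevant_le hVU)) ≤
    (k.glue.ker.comap (𝒜.projι U)).comap (Proj.map (𝒜.res hVU) (𝒜.irrelevant_le hVU))
  rw [← Scheme.IdealSheafData.comap_comp, map_projι, k.ker_glue_comap V hV,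
    ← Scheme.IdealSheafData.le_map_iff_comap_le, ← Scheme.Hom.ker_comp]
  exact h V hV hVU

end LocalClosedImmersion

end GradedAlgebraData

/-! ### The closed immersion of the blowup into ℙE^∨ and its kernel. -/

section Comparison

open Module Scheme.AffineZariskiSite

variable {S : Scheme.{u}} {E : S.Modules} {s : Γ(E, ⊤)}

/-- The linear form `x ↦ x ∧ s` on the sections of `E` over an affine open contained in a chart. -/
def RegularChart.form (C : RegularChart s) {V : S.AffineZariskiSite} (h : V ≤ C.U) :
    Γ(E, V.toOpens) →ₗ[Γ(S, V.toOpens)] Γ(S, V.toOpens) :=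
  wedgeForm (C.isFrame.basis (toOpens_mono h)) (moduleRes E le_top s)

lemma RegularChart.res_form (C : RegularChart s) {V W : S.AffineZariskiSite} (h : V ≤ C.U)
    (h' : W ≤ V) (x : Γ(E, V.toOpens)) :
    (S.presheaf.map (homOfLE (toOpens_mono h')).op).hom (C.form h x) =
      C.form (h'.trans h) (moduleRes E (toOpens_mono h') x) := by
  rw [form, form, wedgeForm_semilinear (moduleRes E (toOpens_mono h')) _
    (C.isFrame.basis (toOpens_mono (h'.trans h)))
    (C.isFrame.basis_res (toOpens_mono h) (toOpens_mono h')), moduleRes_res]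

variable [SheafOfModules.IsQuasicoherent (R := S.ringCatSheaf) E]

lemma RegularChart.range_form (hE : HasRank E 2) (C : RegularChart s) {V : S.AffineZariskiSite}
    (h : V ≤ C.U) : LinearMap.range (C.form h) = idealOn (zeroIdeal s) V :=
  (range_wedgeForm _ _).trans (zeroIdeal_ideal hE s ⟨V.toOpens, V.2⟩).symm

/-- The graded homomorphism `Sym E → ⨁ₙ Iⁿ` over an affine open contained in a chart. -/
def RegularChart.gradedHom (hE : HasRank E 2) (C : RegularChart s) {V : S.AffineZariskiSite}
    (h : V ≤ C.U) : (symAlgebra E).deg V →+*ᵍ (reesData (zeroIdeal s)).deg V :=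
  symToRees (idealOn (zeroIdeal s) V) (C.form h) (C.range_form hE h).le

lemma RegularChart.gradedHom_surjective (hE : HasRank E 2) (C : RegularChart s)
    {V : S.AffineZariskiSite} (h : V ≤ C.U) : Function.Surjective (C.gradedHom hE h) :=
  symToRees_surjective (C.range_form hE h)

/-- The closed immersion from the blowup to the projective bundle over an affine open contained in
a chart. -/
def RegularChart.projHom (hE : HasRank E 2) (C : RegularChart s) {V : S.AffineZariskiSite}
    (h : V ≤ C.U) : Proj ((reesData (zeroIdeal s)).deg V) ⟶ Proj ((symAlgebra E).deg V) :=
  Proj.map (C.gradedHom hE h) (irrelevant_le_map_of_surjective _ (C.gradedHom_surjective hE h))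

/-- Two frames give homomorphisms that differ by uⁿ in degree n, which Proj does not see. This makes
the local closed immersions independent of the chosen chart. -/
lemma RegularChart.projHom_eq (hE : HasRank E 2) (C C' : RegularChart s)
    {V : S.AffineZariskiSite} (h : V ≤ C.U) (h' : V ≤ C'.U) :
    C.projHom hE h = C'.projHom hE h' := by
  obtain ⟨u, hu⟩ := exists_wedgeForm_eq_mul (C.isFrame.basis (toOpens_mono h))
    (C'.isFrame.basis (toOpens_mono h')) (moduleRes E le_top s)
  exact projMap_eq_of_eq_mul_pow _ _ _ _ (SetLike.algebraMap_mem_graded _ u)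
    fun n x hx ↦ symToRees_smul _ _ u hu hx

lemma RegularChart.projHom_toSpec (hE : HasRank E 2) (C : RegularChart s)
    {V : S.AffineZariskiSite} (h : V ≤ C.U) :
    C.projHom hE h ≫ projToSpec ((symAlgebra E).deg V) =
      projToSpec ((reesData (zeroIdeal s)).deg V) := by
  refine (IsGradedLocalizationAway.projToSpec_naturality (R := Γ(S, V.toOpens))
    (R' := Γ(S, V.toOpens)) _ (symToRees_algebraMap (C.range_form hE h).le)).trans ?_
  exact (congrArg _ (Spec.map_id _)).trans (Category.comp_id _)

lemma RegularChart.gradedHom_comp_res (hE : HasRank E 2) (C : RegularChart s)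
    {V W : S.AffineZariskiSite} (h : V ≤ C.U) (h' : W ≤ V) :
    ((reesData (zeroIdeal s)).res h').comp (C.gradedHom hE h) =
      (C.gradedHom hE (h'.trans h)).comp ((symAlgebra E).res h') :=
  reesMap_comp_symToRees (C.range_form hE h).le ((zeroIdeal s).map_ideal (U := ⟨W.toOpens, W.2⟩)
    (V := ⟨V.toOpens, V.2⟩) (toOpens_mono h')).le (C.range_form hE _).le (C.res_form h h')

lemma RegularChart.projHom_naturality (hE : HasRank E 2) (C : RegularChart s)
    {V W : S.AffineZariskiSite} (h : V ≤ C.U) (h' : W ≤ V) :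
    Proj.map ((reesData (zeroIdeal s)).res h') ((reesData (zeroIdeal s)).irrelevant_le h') ≫
      C.projHom hE h =
    C.projHom hE (h'.trans h) ≫ Proj.map ((symAlgebra E).res h')
      ((symAlgebra E).irrelevant_le h') := by
  rw [projHom, projHom, ← Proj.map_comp, ← Proj.map_comp]
  congr 1
  exact C.gradedHom_comp_res hE h h'

/-- The closed immersions `RegularChart.projHom` over all affine opens contained in a chart. -/
def localClosedImmersion [IsLocallyNoetherian S] (hE : HasRank E 2) (hs : IsRegularSection 2 s) :
    GradedAlgebraData.LocalClosedImmersion (symAlgebra E) (reesData (zeroIdeal s)) where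
  basis V := ∃ C : RegularChart s, V ≤ C.U
  mono h := fun ⟨C, h'⟩ ↦ ⟨C, h.trans h'⟩
  exists_mem x :=
    have ⟨C, hx⟩ := exists_regularChart hE s hs x
    ⟨C.U, ⟨C, le_rfl⟩, hx⟩
  hom _ h := h.choose.projHom hE h.choose_spec
  isClosedImmersion _ h := isClosedImmersion_projMap _ (h.choose.gradedHom_surjective hE _)
  hom_toSpec _ h := h.choose.projHom_toSpec hE _
  naturality h h' := by
    rw [RegularChart.projHom_naturality hE _ h'.choose_spec h]
    -- The chart chosen for the smaller open may differ from the one for the larger; independence of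
    -- the chart closes the gap.
    congr 1
    exact RegularChart.projHom_eq hE _ _ _ _

lemma localClosedImmersion_hom [IsLocallyNoetherian S] (hE : HasRank E 2)
    (hs : IsRegularSection 2 s) (C : RegularChart s) {V : S.AffineZariskiSite} (h : V ≤ C.U) :
    (localClosedImmersion hE hs).hom V ⟨C, h⟩ = C.projHom hE h :=
  RegularChart.projHom_eq hE _ _ _ _

/-- Regularity of the components enters here: homogeneous elements of the kernel are divisible by s.
-/
lemma RegularChart.ker_projHom_le (hE : HasRank E 2) (C : RegularChart s) :
    (C.projHom hE le_rfl).ker ≤ projZeroIdeal (symDeg Γ(S, C.U.toOpens) Γ(E, C.U.toOpens))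
      (ι_mem_symDeg (moduleRes E le_top s)) := by
  refine ker_le_projZeroIdeal _ _ _ fun n x hx hx0 ↦ ?_
  let e := C.isFrame.basis (le_refl C.U.toOpens)
  have he : Submodule.span Γ(S, C.U.toOpens) {e 0, e 1} = ⊤ := by
    rw [← e.span_eq]
    congr 1
    ext x
    simp [Fin.exists_fin_two, eq_comm]
  have := dvd_of_symToRees_eq_zero (C.range_form hE le_rfl).le he
    (wedgeForm_self_zero e _) (wedgeForm_self_one e _) C.isRegularPair.left C.isRegularPair.right
    n x hx hx0
  rwa [← eq_smul_add_smul e] at this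

/-- That the kernel is contained in the ideal of X is checked on regular charts, which cover S. For
the converse the kernel must compete in the infimum over all affine opens U, and there only s ∧ s =
0 is needed. -/
lemma ker_glue_eq [IsLocallyNoetherian S] (hE : HasRank E 2) (hs : IsRegularSection 2 s) :
    (localClosedImmersion hE hs).glue.ker = projBundleZeroIdeal s := by
  apply le_antisymm
  · refine le_sInf fun J hJ ↦ (localClosedImmersion hE hs).ker_glue_le fun x ↦ ?_
    obtain ⟨C, hx⟩ := exists_regularChart hE s hs x
    refine ⟨C.U, ⟨C, le_rfl⟩, hx, ?_⟩
    rw [localClosedImmersion_hom]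
    exact (C.ker_projHom_le hE).trans (hJ C.U)
  · refine sInf_le fun U ↦ (localClosedImmersion hE hs).le_ker_glue_comap U
      fun V ⟨C, hV⟩ hVU ↦ ?_
    rw [localClosedImmersion_hom, RegularChart.projHom, ← Proj.map_comp]
    refine projZeroIdeal_le_ker _ _ symDeg_succ_le _ ?_
    change C.gradedHom hE hV (symMap (moduleRes E (toOpens_mono hVU))
      (SymmetricAlgebra.ι _ _ (moduleRes E le_top s))) = 0
    rw [symMap_ι, moduleRes_res]
    refine Subtype.ext ((coe_symToRees_ι _ _).trans ?_)
    rw [RegularChart.form, wedgeForm_self]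
    exact map_zero _

end Comparison

end SectionBlowup

end

theorem lemma3p2 {S : Scheme.{u}} [IsLocallyNoetherian S] (E : S.Modules)
    [SheafOfModules.IsLocallyFree (R := S.ringCatSheaf) E] (hE : HasRank E 2)
    (s : Γ(E, ⊤)) (hs : IsRegularSection 2 s) :
    ∃ φ : (projBundleZeroIdeal s).subscheme ≅ blowup (zeroIdeal s),
      φ.hom ≫ blowupπ (zeroIdeal s) =
        (projBundleZeroIdeal s).subschemeι ≫ projBundleπ E := by
  let k : blowup (zeroIdeal s) ⟶ projBundle E := (localClosedImmersion hE hs).glue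
  have : IsClosedImmersion k :=
    inferInstanceAs (IsClosedImmersion (localClosedImmersion hE hs).glue)
  have hk : k ≫ projBundleπ E = blowupπ (zeroIdeal s) := (localClosedImmersion hE hs).glue_toBase
  have hker : k.ker = (projBundleZeroIdeal s).subschemeι.ker :=
    (ker_glue_eq hE hs).trans (Scheme.IdealSheafData.ker_subschemeι _).symm
  -- X and the blowup are closed in ℙE^∨ with the same kernel, so the inclusion of X factors through
  -- k by an isomorphism.
  let f := IsClosedImmersion.lift k (projBundleZeroIdeal s).subschemeι hker.le
  have hf : f ≫ k = (projBundleZeroIdeal s).subschemeι := IsClosedImmersion.lift_fac _ _ _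
  have : IsIso f := IsClosedImmersion.isIso_of_ker_eq _ _ f hf hker.symm
  exact ⟨asIso f, by rw [asIso_hom, ← hk, ← Category.assoc, hf]⟩
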